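/- Let $\Sigma$ be a Riemann surface and let $\underline{\mathbb C}^{n+2}=\Sigma\times\mathbb C^{n+2}$ carry the complex bilinear extension of the Lorentzian metric of $\mathbb R^{n+1,1}$; write $d$ for the trivial connection. For a smooth non-degenerate complex subbundle $V\subset\underline{\mathbb C}^{n+2}$ with orthogonal projections $\pi_V,\pi_{V^\perp}$ put $\rho=\pi_V-\pi_{V^\perp}$. For a connection $\nabla$ put $\mathcal D_V^{\nabla}=\pi_V\circ\nabla\circ\pi_V+\pi_{V^\perp}\circ\nabla\circ\pi_{V^\perp}$ and $\mathcal N_V^{\nabla}=\nabla-\mathcal D_V^{\nabla}$, and for a $1$-form $q$ with values in $\wedge^2V\oplus\wedge^2V^\perp\subset o(\underline{\mathbb C}^{n+2})$ and $\lambda\in\mathbb C\setminus\{0\}$ put $$\nabla^{\lambda,q}_V=\mathcal D_V^{\nabla}+\lambda^{-1}(\mathcal N_V^{\nabla})^{1,0}+\lambda(\mathcal N_V^{\nabla})^{0,1}+(\lambda^{-2}-1)q^{1,0}+(\lambda^{2}-1)q^{0,1}.$$ $V$ is called $(q,\nabla)$-constrained harmonic if $q$ is such a smooth form and $\nabla^{\lambda,q}_V$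 is a flat metric connection for all $\lambda\in\mathbb C\setminus\{0\}$; if $\nabla=d$ it is called $q$-constrained harmonic. Let $V$ be $q$-constrained harmonic. Let $r(\lambda)$ be a family of smooth sections of $O(\underline{\mathbb C}^{n+2})$, rational in $\lambda$ (a polynomial in $\lambda$ with smooth endomorphism-valued coefficients divided by a non-zero complex polynomial in $\lambda$), holomorphic and invertible at $0$ and $\infty$, and twisted: $\rho\,r(\lambda)\,\rho^{-1}=r(-\lambda)$ on the domain of $r$. Suppose that $\lambda\mapsto r(\lambda)\circ d^{\lambda,q}_V\circ r(\lambda)^{-1}$ extends to a holomorphic family $\lambda\mapsto\hat d(\lambda)$, $\lambda\in\mathbb C\setminus\{0\}$, of metric connections on $\underline{\mathbb C}^{n+2}$. Define $\hat q$ by $\hat q^{1,0}=\mathrm{Ad}_{r(0)}q^{1,0}$, $\hat q^{0,1}=\mathrm{Ad}_{r(\infty)}q^{0,1}$. Then: 1. $\hat d:=\hat d(1)=\lim_{\lambda\to1}r(\lambda)\circ d^{\lambda,q}_V\circ r(\lambda)^{-1}$ is a flat metric connection, and for all $\lambda\in\mathbb C\setminus\{0\}$ $$\hat d(\lambda)=\mathcal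 D_V^{\hat d}+\lambda^{-1}(\mathcal N_V^{\hat d})^{1,0}+\lambda(\mathcal N_V^{\hat d})^{0,1}+(\lambda^{-2}-1)\hat q^{1,0}+(\lambda^{2}-1)\hat q^{0,1};$$ 2. $V$ is $(\hat q,\hat d)$-constrained harmonic; 3. if $1$ lies in the domain of $r$, then $r(1)^{-1}V$ is a (smooth, non-degenerate) $\mathrm{Ad}_{r(1)^{-1}}\hat q$-constrained harmonic bundle. -/

import Mathlib

open scoped Manifold ContDiff Topology
open Filter

noncomputable section

namespace DressingTheory

/-! ### Linear algebra in the complexified Lorentz space -/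

/-- The complexification `ℂ^{n+2}` of `ℝ^{n+1,1}`.  The norm (the sup norm) only serves to speak of
smoothness and limits. -/
def E (n : ℕ) : Type := Fin (n + 2) → ℂ

instance (n : ℕ) : NormedAddCommGroup (E n) :=
  inferInstanceAs (NormedAddCommGroup (Fin (n + 2) → ℂ))

instance (n : ℕ) : NormedSpace ℂ (E n) := inferInstanceAs (NormedSpace ℂ (Fin (n + 2) → ℂ))

instance (n : ℕ) : FiniteDimensional ℂ (E n) :=
  inferInstanceAs (FiniteDimensional ℂ (Fin (n + 2) → ℂ))

/-- Complex-linear endomorphisms of `ℂ^{n+2}`. -/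
abbrev EndE (n : ℕ) : Type := E n →L[ℂ] E n

/-- The complex bilinear extension `(x, y) = x₀ y₀ + ⋯ + xₙ yₙ - xₙ₊₁ yₙ₊₁` of the Lorentzian
metric of `ℝ^{n+1,1}`. -/
def metric (n : ℕ) : LinearMap.BilinForm ℂ (E n) :=
  LinearMap.mk₂ ℂ
    (fun x y : E n => ∑ i : Fin (n + 2), (if i = Fin.last (n + 1) then -1 else 1) * (x i * y i))
    (fun x x' y => by
      rw [← Finset.sum_add_distrib]
      refine Finset.sum_congr rfl fun i _ => ?_
      have h : (x + x') i = x i + x' i := rfl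
      rw [h]; ring)
    (fun c x y => by
      rw [smul_eq_mul, Finset.mul_sum]
      refine Finset.sum_congr rfl fun i _ => ?_
      have h : (c • x) i = c * x i := rfl
      rw [h]; ring)
    (fun x y y' => by
      rw [← Finset.sum_add_distrib]
      refine Finset.sum_congr rfl fun i _ => ?_
      have h : (y + y') i = y i + y' i := rfl
      rw [h]; ring)
    (fun c x y => by
      rw [smul_eq_mul, Finset.mul_sum]
      refine Finset.sum_congr rfl fun i _ => ?_
      have h : (c • y) i = c * y i := rfl
      rw [h]; ring)

theorem metric_apply (n : ℕ) (x y : E n) :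
    metric n x y =
      ∑ i : Fin (n + 2), (if i = Fin.last (n + 1) then -1 else 1) * (x i * y i) := rfl

theorem metric_isSymm (n : ℕ) : (metric n).IsSymm :=
  ⟨fun x y => by
    simp only [metric_apply]
    exact Finset.sum_congr rfl fun i _ => by rw [mul_comm (x i)]⟩

/-- `T` belongs to the complex orthogonal group `O(ℂ^{n+2})`. -/
def IsOrthogonal {n : ℕ} (T : EndE n) : Prop :=
  ∀ x y : E n, metric n (T x) (T y) = metric n x y

/-- The endomorphism `u ∧ v`, `(u ∧ v) w = (u, w) v - (v, w) u`. -/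
def wedge {n : ℕ} (u v : E n) : EndE n :=
  LinearMap.toContinuousLinearMap
    ((metric n u).smulRight v - (metric n v).smulRight u)

/-- `∧² W`, as a space of endomorphisms of `ℂ^{n+2}`. -/
def wedgeSq {n : ℕ} (W : Submodule ℂ (E n)) : Submodule ℂ (EndE n) :=
  Submodule.span ℂ {X | ∃ u ∈ W, ∃ v ∈ W, X = wedge u v}

/-- The adjoint action `Ad_T X = T X T⁻¹` (meaningful for invertible `T`). -/
def Ad {n : ℕ} (T : EndE n) : EndE n →L[ℂ] EndE n :=
  LinearMap.toContinuousLinearMap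
    { toFun := fun X => T * X * Ring.inverse T
      map_add' := fun X Y => by rw [mul_add, add_mul]
      map_smul' := fun c X => by ext x; simp }

/-! ### One-forms on a Riemann surface -/

section Surface

variable (S : Type*) [TopologicalSpace S] [ChartedSpace ℂ S]

/-- Real-linear one-forms on the surface with values in a complex vector space `F`.  The real
tangent space at `p` is `ℂ`, identified through the preferred holomorphic chart at `p`. -/
abbrev OneForm (F : Type*) [NormedAddCommGroup F] [NormedSpace ℂ F] : Type _ :=
  (p : S) → TangentSpace 𝓘(ℝ, ℂ) p →L[ℝ] F

variable {S}

/-- The complex structure `J` of the tangent plane at `p`: multiplication by `i` in a holomorphic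
chart. -/
def J (p : S) : TangentSpace 𝓘(ℝ, ℂ) p →L[ℝ] TangentSpace 𝓘(ℝ, ℂ) p :=
  (ContinuousLinearMap.mul ℝ ℂ Complex.I : ℂ →L[ℝ] ℂ)

variable {F : Type*} [NormedAddCommGroup F] [NormedSpace ℂ F]

/-- The `(1,0)`-part `α^{1,0} = (α - i α ∘ J) / 2`. -/
def part10 (α : OneForm S F) : OneForm S F := fun p =>
  (1 / 2 : ℂ) • (α p - Complex.I • (α p).comp (J p))

/-- The `(0,1)`-part `α^{0,1} = (α + i α ∘ J) / 2`. -/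
def part01 (α : OneForm S F) : OneForm S F := fun p =>
  (1 / 2 : ℂ) • (α p + Complex.I • (α p).comp (J p))

/-- Smoothness (in the real sense) of a map from the surface to a complex vector space. -/
def Smooth (f : S → F) : Prop := ContMDiff 𝓘(ℝ, ℂ) 𝓘(ℝ, F) ∞ f

/-- The differential `d f` of a vector-valued function. -/
def diff (f : S → F) : OneForm S F := fun p => mvfderiv 𝓘(ℝ, ℂ) f p

/-- The pull-back of a one-form by the inverse of the preferred chart at `p₀`: a one-form on the
image (an open subset of `ℂ`) of that chart. -/
def inChart (α : OneForm S F) (p₀ : S) (z : ℂ) : ℂ →L[ℝ] F :=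
  (α ((extChartAt 𝓘(ℝ, ℂ) p₀).symm z)).comp
    (mfderiv 𝓘(ℝ, ℂ) 𝓘(ℝ, ℂ) (extChartAt 𝓘(ℝ, ℂ) p₀).symm z)

/-- Smoothness of a one-form, read in charts. -/
def SmoothForm (α : OneForm S F) : Prop :=
  ∀ p₀ : S, ContDiffOn ℝ ∞ (inChart α p₀) (extChartAt 𝓘(ℝ, ℂ) p₀).target

/-! ### Connections on the trivial bundle `S × ℂ^{n+2}` -/

variable (S) in
/-- Differential operators from sections of the trivial bundle to one-forms with values in it. -/
abbrev Op (n : ℕ) : Type _ := (S → E n) → OneForm S (E n)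

variable (S) in
/-- A smooth (complex-linear) connection `∇ = d + A` on the trivial bundle, given by its connection
form `A`. -/
structure Connection (n : ℕ) where
  form : OneForm S (EndE n)
  smooth : SmoothForm form

/-- The covariant derivative `∇ s = d s + A s`. -/
def Connection.op {n : ℕ} (D : Connection S n) : Op S n := fun s p =>
  diff s p + ((ContinuousLinearMap.apply ℂ (E n) (s p)).restrictScalars ℝ).comp (D.form p)

variable (S) in
/-- The trivial connection `d`. -/
def trivialConnection (n : ℕ) : Connection S n where
  form := 0
  smooth := fun p₀ => by
    have h : inChart (0 : OneForm S (EndE n)) p₀ = 0 := by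
      funext z; exact ContinuousLinearMap.zero_comp _
    rw [h]; exact contDiffOn_const

/-- A metric connection: `d (s, t) = (∇ s, t) + (s, ∇ t)`. -/
def Connection.IsMetric {n : ℕ} (D : Connection S n) : Prop :=
  ∀ s t : S → E n, Smooth s → Smooth t → ∀ (p : S) (v : TangentSpace 𝓘(ℝ, ℂ) p),
    diff (fun x => metric n (s x) (t x)) p v
      = metric n (D.op s p v) (t p) + metric n (s p) (D.op t p v)

/-- A flat connection: the curvature `d A + A ∧ A` vanishes, i.e. in every chart
`∂_v A(w) - ∂_w A(v) + [A(v), A(w)] = 0`. -/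
def Connection.IsFlat {n : ℕ} (D : Connection S n) : Prop :=
  ∀ p₀ : S, ∀ z ∈ (extChartAt 𝓘(ℝ, ℂ) p₀).target, ∀ v w : ℂ,
    fderiv ℝ (inChart D.form p₀) z v w - fderiv ℝ (inChart D.form p₀) z w v
      + (inChart D.form p₀ z v * inChart D.form p₀ z w
        - inChart D.form p₀ z w * inChart D.form p₀ z v) = 0

/-- The operator `P` is the connection `D` (they agree on smooth sections). -/
def Connection.Represents {n : ℕ} (D : Connection S n) (P : Op S n) : Prop :=
  ∀ s : S → E n, Smooth s → P s = D.op s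

/-- The gauging `g ∘ P ∘ g⁻¹` of an operator by a field `g` of invertible endomorphisms. -/
def gauge {n : ℕ} (g : S → EndE n) (P : Op S n) : Op S n := fun s p =>
  ((g p).restrictScalars ℝ).comp (P (fun x => Ring.inverse (g x) (s x)) p)

/-! ### Non-degenerate subbundles and constrained harmonicity -/

variable (S) in
/-- A smooth complex subbundle of `S × ℂ^{n+2}` whose fibres are non-degenerate for the metric. -/
structure NondegSubbundle (n : ℕ) where
  fiber : S → Submodule ℂ (E n)
  nondeg : ∀ p, ((metric n).restrict (fiber p)).Nondegenerate
  smooth : ∀ p₀ : S, ∃ U : Set S, IsOpen U ∧ p₀ ∈ U ∧ ∃ (k : ℕ) (s : Fin k → S → E n),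
    (∀ i, ContMDiffOn 𝓘(ℝ, ℂ) 𝓘(ℝ, E n) ∞ (s i) U) ∧
    ∀ p ∈ U, LinearIndependent ℂ (fun i => s i p) ∧
      fiber p = Submodule.span ℂ (Set.range fun i => s i p)

namespace NondegSubbundle

variable {n : ℕ} (V : NondegSubbundle S n)

/-- The fibres of `V^⊥`. -/
def perp (p : S) : Submodule ℂ (E n) := (metric n).orthogonal (V.fiber p)

theorem isCompl (p : S) : IsCompl (V.fiber p) (V.perp p) :=
  LinearMap.BilinForm.isCompl_orthogonal_of_restrict_nondegenerate
    (metric_isSymm n).isRefl (V.nondeg p)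

/-- The orthogonal projection `π_V`. -/
def proj (p : S) : EndE n :=
  LinearMap.toContinuousLinearMap ((V.fiber p).projection (V.perp p) (V.isCompl p))

/-- The orthogonal projection `π_{V^⊥}`. -/
def projPerp (p : S) : EndE n :=
  LinearMap.toContinuousLinearMap ((V.perp p).projection (V.fiber p) (V.isCompl p).symm)

/-- The reflection `ρ = π_V - π_{V^⊥}` across `V`. -/
def refl (p : S) : EndE n := V.proj p - V.projPerp p

/-- `𝒟_V^∇`: the sum of the connections induced by `∇` on `V` and `V^⊥`,
`s ↦ π_V ∇ (π_V s) + π_{V^⊥} ∇ (π_{V^⊥} s)`. -/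
def parallelPart (D : Connection S n) : Op S n := fun s p =>
  ((V.proj p).restrictScalars ℝ).comp (D.op (fun x => V.proj x (s x)) p)
    + ((V.projPerp p).restrictScalars ℝ).comp (D.op (fun x => V.projPerp x (s x)) p)

/-- `𝒩_V^∇ = ∇ - 𝒟_V^∇`. -/
def normalPart (D : Connection S n) : Op S n := fun s => D.op s - V.parallelPart D s

/-- The operator
`∇^{μ,q}_V = 𝒟_V^∇ + μ⁻¹ (𝒩_V^∇)^{1,0} + μ (𝒩_V^∇)^{0,1} + (μ⁻² - 1) q^{1,0} + (μ² - 1) q^{0,1}`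
of spectral parameter `μ`. -/
def family (D : Connection S n) (q : OneForm S (EndE n)) (μ : ℂ) : Op S n := fun s p =>
  V.parallelPart D s p
    + μ⁻¹ • part10 (V.normalPart D s) p + μ • part01 (V.normalPart D s) p
    + ((ContinuousLinearMap.apply ℂ (E n) (s p)).restrictScalars ℝ).comp
        ((μ⁻¹ ^ 2 - 1) • part10 q p + (μ ^ 2 - 1) • part01 q p)

/-- `V` is `(q, ∇)`-constrained harmonic: `q` is a smooth one-form with values in
`∧² V ⊕ ∧² V^⊥`, and `∇^{μ,q}_V` is a flat metric connection for every `μ ≠ 0`. -/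
def IsConstrainedHarmonic (D : Connection S n) (q : OneForm S (EndE n)) : Prop :=
  SmoothForm q ∧
  (∀ (p : S) (v : TangentSpace 𝓘(ℝ, ℂ) p), q p v ∈ wedgeSq (V.fiber p) ⊔ wedgeSq (V.perp p)) ∧
  ∀ μ : ℂ, μ ≠ 0 →
    ∃ D' : Connection S n, D'.Represents (V.family D q μ) ∧ D'.IsMetric ∧ D'.IsFlat

end NondegSubbundle

/-! ### Rational families of endomorphisms -/

variable (S) in
/-- A family `μ ↦ r(μ)` of smooth endomorphism fields, rational in the parameter: a fraction
`(a₀ + μ a₁ + ⋯ + μ^N a_N) / Q(μ)` with smooth endomorphism fields `aᵢ` and a non-zero complex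
polynomial `Q`. -/
structure RationalFamily (n : ℕ) where
  deg : ℕ
  num : ℕ → S → EndE n
  smooth : ∀ i, Smooth (num i)
  den : Polynomial ℂ
  den_ne_zero : den ≠ 0

namespace RationalFamily

variable {n : ℕ} (r : RationalFamily S n)

/-- The finite part of the domain of the family. -/
def dom : Set ℂ := {μ | r.den.eval μ ≠ 0}

/-- The value `r(μ)`, for `μ` in the domain. -/
def val (μ : ℂ) (p : S) : EndE n :=
  (r.den.eval μ)⁻¹ • ∑ i ∈ Finset.range (r.deg + 1), μ ^ i • r.num i p

/-- The family is holomorphic at `∞`, with value `rinf` there. -/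
def HolomorphicAtInfinity (rinf : S → EndE n) : Prop :=
  ∀ p : S, Tendsto (fun μ : ℂ => r.val μ p) (cocompact ℂ) (𝓝 (rinf p))

end RationalFamily

/-- `Ad_T q` for an endomorphism-valued one-form `q`. -/
def adForm {n : ℕ} (T : S → EndE n) (q : OneForm S (EndE n)) : OneForm S (EndE n) := fun p =>
  ((Ad (T p)).restrictScalars ℝ).comp (q p)

/-- The one-form `Ad_{T₀} q^{1,0} + Ad_{T₁} q^{0,1}`. -/
def dressedForm {n : ℕ} (T₀ T₁ : S → EndE n) (q : OneForm S (EndE n)) : OneForm S (EndE n) :=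
  adForm T₀ (part10 q) + adForm T₁ (part01 q)

end Surface

end DressingTheory

end

/-! Write a connection as `∇ = d + A`. In terms of the reflection `ρ`, its normal part is a
zeroth-order operator, the endomorphism-valued form `(A - ρAρ - ρ dρ)/2`. Every operator in the
statement is therefore `d` plus a form, and gauging by `g` becomes the equation `A' g = g A - dg`
(`GaugeRel`).

The heart is a Liouville argument in the spectral parameter `μ`. Let `Â(μ)` be the form of the
extended family, holomorphic on `ℂ ∖ {0}`. As `r` is holomorphic and invertible at `0` and `∞`,
gauging by it keeps the growth of the original family. The (1,0)-part of `Â` is `O(μ⁻²)` at `0`,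
with leading coefficient `Ad_{r(0)} q^{1,0}`, and has a limit at `∞`. The (0,1)-part has a limit at
`0` and is `O(μ²)` at `∞`, with leading coefficient `Ad_{r(∞)} q^{0,1}`. Each part is thus a Laurent
polynomial with three terms (`eq_quadratic_of_tendsto`, `dressed_part10`, `dressed_part01`). The
middle coefficient comes from the twisting: `ρ` gauges `Â(μ)` into `Â(-μ)`, so `(Â(1) - Â(-1))/2` is
the normal part of the limit connection (`twist_one`). The value at `μ = 1` fixes the constant term,
and `dressed_form_eq` collects the result.

Flatness is gauge invariant away from the poles of `r`. It extends over the poles because the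
Laurent polynomial has coefficients smooth on the surface (`NondegSubbundle.isFlat_of_eventually`).
The values of the dressed form stay in `∧²V ⊕ ∧²V^⊥` because `0` and `∞` are fixed by `μ ↦ -μ`, so
that `r(0)` and `r(∞)` commute with `ρ`. Finally, `r(1)⁻¹` gauges the limit connection back to `d`,
and the spectral family is natural under gauges (`NondegSubbundle.gaugeRel_familyForm`). -/

noncomputable section

namespace DressingTheory

/-! ### Calculus of vector-valued functions and one-forms on the surface; curvature under gauging.
-/

section Calculus

variable {S : Type*} [TopologicalSpace S] [ChartedSpace ℂ S]
variable {F : Type*} [NormedAddCommGroup F] [NormedSpace ℂ F]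
variable {G : Type*} [NormedAddCommGroup G] [NormedSpace ℂ G]
variable {H : Type*} [NormedAddCommGroup H] [NormedSpace ℂ H]

/-- Complex `C¹` transition maps on open sets are holomorphic, hence real smooth. -/
instance isManifold_real [IsManifold 𝓘(ℂ) 1 S] : IsManifold 𝓘(ℝ, ℂ) ∞ S := by
  refine isManifold_of_contDiffOn _ _ _ fun e e' he he' => ?_
  have h : ContDiffOn ℂ 1 (e.symm.trans e') (e.symm.trans e').source := by
    rw [← contMDiffOn_iff_contDiffOn]
    exact contMDiffOn_of_mem_contDiffGroupoid
      (HasGroupoid.compatible (G := contDiffGroupoid 1 𝓘(ℂ)) he he')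
  have h2 : ContDiffOn ℂ ∞ (e.symm.trans e') (e.symm.trans e').source :=
    (h.differentiableOn one_ne_zero).contDiffOn (e.symm.trans e').open_source
  simpa using h2.restrict_scalars ℝ

theorem Smooth.mdifferentiableAt {f : S → F} (hf : Smooth f) (p : S) :
    MDifferentiableAt 𝓘(ℝ, ℂ) 𝓘(ℝ, F) f p :=
  (hf p).mdifferentiableAt (by simp)

theorem diff_eq_fderiv {f : S → F} (hf : Smooth f) (p : S) :
    diff f p = fderiv ℝ (f ∘ (extChartAt 𝓘(ℝ, ℂ) p).symm) (extChartAt 𝓘(ℝ, ℂ) p p) := by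
  have h : mfderiv 𝓘(ℝ, ℂ) 𝓘(ℝ, F) f p
      = fderiv ℝ (f ∘ (extChartAt 𝓘(ℝ, ℂ) p).symm) (extChartAt 𝓘(ℝ, ℂ) p p) := by
    refine (hf.mdifferentiableAt p).mfderiv.trans ?_
    rw [modelWithCornersSelf_coe, Set.range_id, fderivWithin_univ]
    rfl
  rw [← h]
  rfl

theorem isOpen_chart_target (p₀ : S) : IsOpen (extChartAt 𝓘(ℝ, ℂ) p₀).target :=
  isOpen_extChartAt_target p₀

theorem contDiff_bilinear (L : F →L[ℂ] G →L[ℂ] H) :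
    ContDiff ℝ ∞ (fun x : F × G => L x.1 x.2) :=
  (L.isBoundedBilinearMap.contDiff (n := ∞)).restrict_scalars ℝ

theorem ContMDiffOn.bilinear (L : F →L[ℂ] G →L[ℂ] H) {f : S → F} {g : S → G} {U : Set S}
    (hf : ContMDiffOn 𝓘(ℝ, ℂ) 𝓘(ℝ, F) ∞ f U) (hg : ContMDiffOn 𝓘(ℝ, ℂ) 𝓘(ℝ, G) ∞ g U) :
    ContMDiffOn 𝓘(ℝ, ℂ) 𝓘(ℝ, H) ∞ (fun p => L (f p) (g p)) U :=
  (contDiff_bilinear L).contMDiff.comp_contMDiffOn (hf.prodMk_space hg)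

theorem Smooth.bilinear (L : F →L[ℂ] G →L[ℂ] H) {f : S → F} {g : S → G}
    (hf : Smooth f) (hg : Smooth g) : Smooth (fun p => L (f p) (g p)) :=
  (contDiff_bilinear L).contMDiff.comp (ContMDiff.prodMk_space hf hg)

theorem smooth_const (c : F) : Smooth (fun _ : S => c) := contMDiff_const

theorem diff_const (c : F) : diff (fun _ : S => c) = 0 := by
  funext p
  rw [diff_eq_fderiv (smooth_const c)]
  exact fderiv_const_apply c

theorem fderiv_bilinear (L : F →L[ℂ] G →L[ℂ] H) {f : ℂ → F} {g : ℂ → G} {z : ℂ}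
    (hf : DifferentiableAt ℝ f z) (hg : DifferentiableAt ℝ g z) (v : ℂ) :
    fderiv ℝ (fun x => L (f x) (g x)) z v
      = L (fderiv ℝ f z v) (g z) + L (f z) (fderiv ℝ g z v) := by
  have h := (L.bilinearRestrictScalars ℝ).hasFDerivAt_of_bilinear hf.hasFDerivAt hg.hasFDerivAt
  have h' : HasFDerivAt (fun x => L (f x) (g x)) _ z := h
  rw [h'.fderiv, add_comm]
  rfl

theorem Smooth.add {f g : S → F} (hf : Smooth f) (hg : Smooth g) : Smooth (fun p => f p + g p) :=
  ContMDiff.add hf hg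

theorem Smooth.sub {f g : S → F} (hf : Smooth f) (hg : Smooth g) : Smooth (fun p => f p - g p) :=
  ContMDiff.sub hf hg

theorem Smooth.clm (L : F →L[ℂ] G) {f : S → F} (hf : Smooth f) : Smooth (fun p => L (f p)) :=
  ((L.restrictScalars ℝ).contDiff (n := ∞)).contMDiff.comp hf

theorem SmoothForm.add {α β : OneForm S F} (hα : SmoothForm α) (hβ : SmoothForm β) :
    SmoothForm (α + β) := fun p₀ => ((hα p₀).add (hβ p₀)).congr fun _ _ => rfl

theorem SmoothForm.sub {α β : OneForm S F} (hα : SmoothForm α) (hβ : SmoothForm β) :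
    SmoothForm (α - β) := fun p₀ => ((hα p₀).sub (hβ p₀)).congr fun _ _ => rfl

theorem SmoothForm.smul (c : ℂ) {α : OneForm S F} (hα : SmoothForm α) :
    SmoothForm (c • α) := fun p₀ => ((hα p₀).const_smul c).congr fun _ _ => rfl

section

variable [IsManifold 𝓘(ℂ) 1 S]

theorem Smooth.contDiffOn_chart {f : S → F} (hf : Smooth f) (p₀ : S) :
    ContDiffOn ℝ ∞ (f ∘ (extChartAt 𝓘(ℝ, ℂ) p₀).symm) (extChartAt 𝓘(ℝ, ℂ) p₀).target := by
  rw [← contMDiffOn_iff_contDiffOn]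
  exact (ContMDiff.contMDiffOn hf).comp (t := Set.univ)
    (contMDiffOn_extChartAt_symm (I := 𝓘(ℝ, ℂ)) (n := ∞) p₀) (fun _ _ => trivial)

theorem Smooth.differentiableAt_chart {f : S → F} (hf : Smooth f) (p₀ : S) {z : ℂ}
    (hz : z ∈ (extChartAt 𝓘(ℝ, ℂ) p₀).target) :
    DifferentiableAt ℝ (f ∘ (extChartAt 𝓘(ℝ, ℂ) p₀).symm) z :=
  ((hf.contDiffOn_chart p₀).differentiableOn (by simp)).differentiableAt
    ((isOpen_chart_target p₀).mem_nhds hz)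

theorem mdifferentiableAt_chart_symm (p₀ : S) {z : ℂ}
    (hz : z ∈ (extChartAt 𝓘(ℝ, ℂ) p₀).target) :
    MDifferentiableAt 𝓘(ℝ, ℂ) 𝓘(ℝ, ℂ) (extChartAt 𝓘(ℝ, ℂ) p₀).symm z :=
  ((contMDiffOn_extChartAt_symm (I := 𝓘(ℝ, ℂ)) (n := ∞) p₀).contMDiffAt
    ((isOpen_chart_target p₀).mem_nhds hz)).mdifferentiableAt (by simp)

theorem inChart_diff {f : S → F} (hf : Smooth f) (p₀ : S) {z : ℂ}
    (hz : z ∈ (extChartAt 𝓘(ℝ, ℂ) p₀).target) :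
    inChart (diff f) p₀ z = fderiv ℝ (f ∘ (extChartAt 𝓘(ℝ, ℂ) p₀).symm) z := by
  have h := mfderiv_comp z (hf.mdifferentiableAt _) (mdifferentiableAt_chart_symm p₀ hz)
  rw [mfderiv_eq_fderiv] at h
  rw [h]
  rfl

/-- Tangent spaces and `J` are read in the preferred chart of each point, which varies with the
point. The derivative here is that of a transition map, complex linear by holomorphy. This is what
makes types of forms visible, and smooth, in a fixed chart. -/
theorem mfderiv_chart_symm_I (p₀ : S) {z : ℂ}
    (hz : z ∈ (extChartAt 𝓘(ℝ, ℂ) p₀).target) (v : ℂ) :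
    J ((extChartAt 𝓘(ℝ, ℂ) p₀).symm z)
        (mfderiv 𝓘(ℝ, ℂ) 𝓘(ℝ, ℂ) (extChartAt 𝓘(ℝ, ℂ) p₀).symm z v)
      = mfderiv 𝓘(ℝ, ℂ) 𝓘(ℝ, ℂ) (extChartAt 𝓘(ℝ, ℂ) p₀).symm z (Complex.I * v : ℂ) := by
  have hz' : z ∈ (chartAt ℂ p₀).target := by simpa using hz
  set p := (extChartAt 𝓘(ℝ, ℂ) p₀).symm z with hp
  have hp' : p = (chartAt ℂ p₀).symm z := by simp [hp]
  set τ := (chartAt ℂ p₀).symm.trans (chartAt ℂ p) with hτ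
  have h : ContDiffOn ℂ 1 τ τ.source := by
    rw [← contMDiffOn_iff_contDiffOn]
    exact contMDiffOn_of_mem_contDiffGroupoid
      (HasGroupoid.compatible (G := contDiffGroupoid 1 𝓘(ℂ)) (chart_mem_atlas ℂ p₀)
        (chart_mem_atlas ℂ p))
  have hzτ : z ∈ τ.source := by
    simp only [hτ, OpenPartialHomeomorph.trans_source, OpenPartialHomeomorph.symm_source,
      Set.mem_inter_iff, Set.mem_preimage]
    exact ⟨hz', by rw [← hp']; exact mem_chart_source ℂ p⟩
  have hd : DifferentiableAt ℂ τ z :=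
    (h.differentiableOn one_ne_zero).differentiableAt (τ.open_source.mem_nhds hzτ)
  have hm : mfderiv 𝓘(ℝ, ℂ) 𝓘(ℝ, ℂ) (extChartAt 𝓘(ℝ, ℂ) p₀).symm z = fderiv ℝ τ z := by
    refine (mdifferentiableAt_chart_symm p₀ hz).mfderiv.trans ?_
    rw [modelWithCornersSelf_coe, Set.range_id, fderivWithin_univ]
    rfl
  rw [hm, hd.fderiv_restrictScalars ℝ]
  change Complex.I * (fderiv ℂ τ z v) = fderiv ℂ τ z (Complex.I * v)
  rw [← smul_eq_mul Complex.I v, map_smul, smul_eq_mul]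

/-! ### Products and smooth one-forms -/

theorem diff_bilinear (L : F →L[ℂ] G →L[ℂ] H) {f : S → F} {g : S → G}
    (hf : Smooth f) (hg : Smooth g) (p : S) (v : TangentSpace 𝓘(ℝ, ℂ) p) :
    diff (fun x => L (f x) (g x)) p v = L (diff f p v) (g p) + L (f p) (diff g p v) := by
  rw [diff_eq_fderiv (hf.bilinear L hg), diff_eq_fderiv hf, diff_eq_fderiv hg]
  have hp := mem_extChartAt_target (I := 𝓘(ℝ, ℂ)) p
  have h := fderiv_bilinear L (hf.differentiableAt_chart p hp)
    (hg.differentiableAt_chart p hp) v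
  simp only [Function.comp_apply, extChartAt_to_inv] at h
  exact h

theorem diff_add {f g : S → F} (hf : Smooth f) (hg : Smooth g) :
    diff (fun p => f p + g p) = diff f + diff g := by
  funext p
  have hp := mem_extChartAt_target (I := 𝓘(ℝ, ℂ)) p
  rw [diff_eq_fderiv (hf.add hg), Pi.add_apply, diff_eq_fderiv hf, diff_eq_fderiv hg]
  exact fderiv_add (hf.differentiableAt_chart p hp) (hg.differentiableAt_chart p hp)

theorem diff_clm (L : F →L[ℂ] G) {f : S → F} (hf : Smooth f) (p : S)
    (v : TangentSpace 𝓘(ℝ, ℂ) p) : diff (fun p => L (f p)) p v = L (diff f p v) := by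
  have hp := mem_extChartAt_target (I := 𝓘(ℝ, ℂ)) p
  rw [diff_eq_fderiv (hf.clm L), diff_eq_fderiv hf]
  have h := ((L.restrictScalars ℝ).hasFDerivAt.comp _
    (hf.differentiableAt_chart p hp).hasFDerivAt).fderiv
  exact congrArg (fun T : ℂ →L[ℝ] G => T v) h

theorem Smooth.smoothForm_diff {f : S → F} (hf : Smooth f) : SmoothForm (diff f) := fun p₀ =>
  ((hf.contDiffOn_chart p₀).fderiv_of_isOpen (isOpen_chart_target p₀) (by simp)).congr
    fun _ hz => inChart_diff hf p₀ hz

theorem SmoothForm.bilinear (L : F →L[ℂ] G →L[ℂ] H) {f : S → F} {α : OneForm S G}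
    (hf : Smooth f) (hα : SmoothForm α) :
    SmoothForm (fun p => ((L (f p)).restrictScalars ℝ).comp (α p)) := fun p₀ => by
  have h1 : ContDiffOn ℝ ∞
      (fun z => (L.bilinearRestrictScalars ℝ) ((f ∘ (extChartAt 𝓘(ℝ, ℂ) p₀).symm) z))
      (extChartAt 𝓘(ℝ, ℂ) p₀).target :=
    (L.bilinearRestrictScalars ℝ).contDiff.comp_contDiffOn (hf.contDiffOn_chart p₀)
  exact (h1.clm_comp (hα p₀)).congr fun _ _ => rfl

theorem inChart_comp_J (α : OneForm S F) (p₀ : S) {z : ℂ}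
    (hz : z ∈ (extChartAt 𝓘(ℝ, ℂ) p₀).target) :
    inChart (fun p => (α p).comp (J p)) p₀ z
      = (inChart α p₀ z).comp (ContinuousLinearMap.mul ℝ ℂ Complex.I) := by
  ext v
  exact congrArg _ (mfderiv_chart_symm_I p₀ hz v)

theorem SmoothForm.comp_J {α : OneForm S F} (hα : SmoothForm α) :
    SmoothForm (fun p => (α p).comp (J p)) := fun p₀ =>
  ((hα p₀).clm_comp contDiffOn_const).congr fun _ hz => inChart_comp_J α p₀ hz

theorem SmoothForm.part10 {α : OneForm S F} (hα : SmoothForm α) : SmoothForm (part10 α) :=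
  (hα.sub (hα.comp_J.smul Complex.I)).smul (1 / 2)

theorem SmoothForm.part01 {α : OneForm S F} (hα : SmoothForm α) : SmoothForm (part01 α) :=
  (hα.add (hα.comp_J.smul Complex.I)).smul (1 / 2)

end

/-- The curvature of a connection form on an open subset of `ℂ`. -/
def curvature {A : Type*} [NormedRing A] [NormedAlgebra ℝ A] (a : ℂ → ℂ →L[ℝ] A) (z v w : ℂ) : A :=
  fderiv ℝ a z v w - fderiv ℝ a z w v + (a z v * a z w - a z w * a z v)

/-- Differentiate the gauge relation and antisymmetrise: the second derivatives of `g` cancel, and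
the first-order terms are absorbed by the commutators. Invertibility of `g` plays no role. -/
theorem curvature_gauge {A : Type*} [NormedRing A] [NormedAlgebra ℝ A] {U : Set ℂ} (hU : IsOpen U)
    {a a' : ℂ → ℂ →L[ℝ] A} {g : ℂ → A} (ha : ContDiffOn ℝ ∞ a U) (ha' : ContDiffOn ℝ ∞ a' U)
    (hg : ContDiffOn ℝ ∞ g U)
    (h : ∀ z ∈ U, ∀ v, a' z v * g z = g z * a z v - fderiv ℝ g z v) {z : ℂ} (hz : z ∈ U)
    (v w : ℂ) : curvature a' z v w * g z = g z * curvature a z v w := by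
  have hUz := hU.mem_nhds hz
  have da : HasFDerivAt a (fderiv ℝ a z) z :=
    ((ha.differentiableOn (by simp)).differentiableAt hUz).hasFDerivAt
  have da' : HasFDerivAt a' (fderiv ℝ a' z) z :=
    ((ha'.differentiableOn (by simp)).differentiableAt hUz).hasFDerivAt
  have dg : HasFDerivAt g (fderiv ℝ g z) z :=
    ((hg.differentiableOn (by simp)).differentiableAt hUz).hasFDerivAt
  have ddg : HasFDerivAt (fderiv ℝ g) (fderiv ℝ (fderiv ℝ g) z) z :=
    (((hg.fderiv_of_isOpen (m := ∞) hU (by simp)).differentiableOn (by simp)).differentiableAt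
      hUz).hasFDerivAt
  -- The derivative in direction `v` of the gauge relation evaluated on the constant vector `w`.
  have key : ∀ v w : ℂ, fderiv ℝ a' z v w * g z + a' z w * fderiv ℝ g z v
      = fderiv ℝ g z v * a z w + g z * fderiv ℝ a z v w - fderiv ℝ (fderiv ℝ g) z v w := by
    intro v w
    have e1 := (da'.clm_apply (hasFDerivAt_const w z)).mul' dg
    have e2 := (dg.mul' (da.clm_apply (hasFDerivAt_const w z))).sub
      (ddg.clm_apply (hasFDerivAt_const w z))
    have e3 := e1.congr_of_eventuallyEq
      (Filter.eventually_of_mem hUz fun x hx => (h x hx w).symm)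
    have e4 := congrArg (fun T : ℂ →L[ℝ] A => T v) (e3.unique e2)
    simp at e4
    rw [add_comm, e4]
    abel
  have symm : fderiv ℝ (fderiv ℝ g) z v w = fderiv ℝ (fderiv ℝ g) z w v :=
    second_derivative_symmetric_of_eventually
      (Filter.eventually_of_mem hUz fun x hx =>
        ((hg.differentiableOn (by simp)).differentiableAt (hU.mem_nhds hx)).hasFDerivAt) ddg v w
  have k1 := key v w
  have k2 := key w v
  have hv := h z hz v
  have hw := h z hz w
  unfold curvature
  have c1 : a' z v * a' z w * g z
      = (g z * a z v - fderiv ℝ g z v) * a z w - a' z v * fderiv ℝ g z w := by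
    rw [mul_assoc, hw, mul_sub, ← mul_assoc, hv]
  have c2 : a' z w * a' z v * g z
      = (g z * a z w - fderiv ℝ g z w) * a z v - a' z w * fderiv ℝ g z v := by
    rw [mul_assoc, hv, mul_sub, ← mul_assoc, hw]
  rw [symm] at k1
  have k3 := eq_sub_of_add_eq k1
  have k4 := eq_sub_of_add_eq k2
  simp only [add_mul, sub_mul]
  rw [c1, c2, k3, k4]
  noncomm_ring

end Calculus

/-! ### Orthogonal endomorphisms and the adjoint action on `∧²`. -/

section LinearAlgebra

variable {n : ℕ}

instance (n : ℕ) : CompleteSpace (E n) := FiniteDimensional.complete ℂ (E n)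

theorem eq_zero_of_metric_eq_zero {x : E n} (h : ∀ y, metric n x y = 0) : x = 0 := by
  funext i
  have := h (Pi.single i 1 : Fin (n + 2) → ℂ)
  change (∑ j : Fin (n + 2), (if j = Fin.last (n + 1) then -1 else 1) *
    (x j * (Pi.single i 1 : Fin (n + 2) → ℂ) j)) = 0 at this
  change x i = 0
  rw [Finset.sum_eq_single i] at this
  · split_ifs at this <;> simpa using this
  · intro j _ hj
    simp [Pi.single_eq_of_ne hj]
  · simp

theorem metric_comm (x y : E n) : metric n x y = metric n y x := (metric_isSymm n).eq x y

/-- Non-degeneracy of the metric gives injectivity, and finite dimension does the rest. Hence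
`Ring.inverse` is a true inverse on orthogonal endomorphisms. -/
theorem IsOrthogonal.isUnit {T : EndE n} (hT : IsOrthogonal T) : IsUnit T := by
  have hinj : Function.Injective T := by
    rw [injective_iff_map_eq_zero]
    intro x hx
    refine eq_zero_of_metric_eq_zero fun y => ?_
    rw [← hT, hx, map_zero, LinearMap.zero_apply]
  rw [ContinuousLinearMap.isUnit_iff_bijective]
  exact ⟨hinj, LinearMap.surjective_of_injective (f := T.toLinearMap) hinj⟩

theorem IsOrthogonal.mul_inverse {T : EndE n} (hT : IsOrthogonal T) : T * Ring.inverse T = 1 :=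
  Ring.mul_inverse_cancel T hT.isUnit

theorem IsOrthogonal.inverse_mul {T : EndE n} (hT : IsOrthogonal T) : Ring.inverse T * T = 1 :=
  Ring.inverse_mul_cancel T hT.isUnit

theorem apply_apply_of_mul_eq_one {T U : EndE n} (h : T * U = 1) (x : E n) : T (U x) = x :=
  congrArg (fun X : EndE n => X x) h

theorem IsOrthogonal.inverse {T : EndE n} (hT : IsOrthogonal T) : IsOrthogonal (Ring.inverse T) :=
  fun x y => by
    rw [← hT, apply_apply_of_mul_eq_one hT.mul_inverse, apply_apply_of_mul_eq_one hT.mul_inverse]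

theorem IsOrthogonal.metric_apply_left {T : EndE n} (hT : IsOrthogonal T) (x y : E n) :
    metric n (T x) y = metric n x (Ring.inverse T y) := by
  rw [← hT x, apply_apply_of_mul_eq_one hT.mul_inverse]

theorem wedge_apply (u v w : E n) : wedge u v w = metric n u w • v - metric n v w • u := rfl

theorem Ad_apply (T X : EndE n) : Ad T X = T * X * Ring.inverse T := rfl

theorem IsOrthogonal.Ad_wedge {T : EndE n} (hT : IsOrthogonal T) (u v : E n) :
    Ad T (wedge u v) = wedge (T u) (T v) := by
  ext w
  simp only [Ad_apply, mul_apply_eq_comp, wedge_apply, map_sub, map_smul,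
    hT.metric_apply_left]

theorem IsOrthogonal.Ad_mem_wedgeSq {T : EndE n} (hT : IsOrthogonal T) {W W' : Submodule ℂ (E n)}
    (hW : ∀ x ∈ W, T x ∈ W') {X : EndE n} (hX : X ∈ wedgeSq W) : Ad T X ∈ wedgeSq W' := by
  have h : wedgeSq W ≤ (wedgeSq W').comap (Ad T).toLinearMap := by
    refine Submodule.span_le.2 ?_
    rintro _ ⟨u, hu, v, hv, rfl⟩
    exact Submodule.subset_span ⟨T u, hW u hu, T v, hW v hv, hT.Ad_wedge u v⟩
  exact h hX

theorem IsOrthogonal.Ad_mem_sup {T : EndE n} (hT : IsOrthogonal T)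
    {W₁ W₂ W₁' W₂' : Submodule ℂ (E n)} (h₁ : ∀ x ∈ W₁, T x ∈ W₁') (h₂ : ∀ x ∈ W₂, T x ∈ W₂')
    {X : EndE n} (hX : X ∈ wedgeSq W₁ ⊔ wedgeSq W₂) : Ad T X ∈ wedgeSq W₁' ⊔ wedgeSq W₂' := by
  obtain ⟨X₁, hX₁, X₂, hX₂, rfl⟩ := Submodule.mem_sup.1 hX
  rw [map_add]
  exact Submodule.add_mem_sup (hT.Ad_mem_wedgeSq h₁ hX₁) (hT.Ad_mem_wedgeSq h₂ hX₂)

/-- The metric as a continuous bilinear map. -/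
def metricCLM (n : ℕ) : E n →L[ℂ] E n →L[ℂ] ℂ :=
  (metric n).toContinuousBilinearMap

theorem metricCLM_apply (x y : E n) : metricCLM n x y = metric n x y := rfl

theorem isOrthogonal_of_tendsto {ι : Type*} {l : Filter ι} [l.NeBot] {f : ι → EndE n} {T : EndE n}
    (hf : ∀ᶠ i in l, IsOrthogonal (f i)) (h : Tendsto f l (𝓝 T)) : IsOrthogonal T := by
  intro x y
  have hc : Continuous fun X : EndE n => metricCLM n (X x) (X y) :=
    ((metricCLM n).continuous.comp (ContinuousLinearMap.apply ℂ (E n) x).continuous).clm_apply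
      (ContinuousLinearMap.apply ℂ (E n) y).continuous
  have h1 : Tendsto (fun i => metricCLM n (f i x) (f i y)) l (𝓝 (metricCLM n (T x) (T y))) :=
    (hc.tendsto T).comp h
  refine tendsto_nhds_unique h1 (tendsto_const_nhds.congr' ?_)
  filter_upwards [hf] with i hi
  exact (hi x y).symm

end LinearAlgebra

/-! ### Pointwise algebra of the reflection `ρ` of a non-degenerate subbundle. -/

namespace NondegSubbundle

variable {S : Type*} [TopologicalSpace S] [ChartedSpace ℂ S]
variable {n : ℕ} (V : NondegSubbundle S n)

theorem proj_mem (p : S) (x : E n) : V.proj p x ∈ V.fiber p :=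
  Submodule.projection_apply_mem _ x

theorem projPerp_mem (p : S) (x : E n) : V.projPerp p x ∈ V.perp p :=
  Submodule.projection_apply_mem _ x

theorem proj_eq_self {p : S} {x : E n} (hx : x ∈ V.fiber p) : V.proj p x = x :=
  Submodule.projection_apply_of_mem_left (V.isCompl p) hx

theorem proj_eq_zero {p : S} {x : E n} (hx : x ∈ V.perp p) : V.proj p x = 0 :=
  Submodule.projection_apply_of_mem_right (V.isCompl p) hx

theorem projPerp_eq_self {p : S} {x : E n} (hx : x ∈ V.perp p) : V.projPerp p x = x :=
  Submodule.projection_apply_of_mem_left (V.isCompl p).symm hx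

theorem projPerp_eq_zero {p : S} {x : E n} (hx : x ∈ V.fiber p) : V.projPerp p x = 0 :=
  Submodule.projection_apply_of_mem_right (V.isCompl p).symm hx

theorem ext_fiber_perp {p : S} {T U : EndE n} (h₁ : ∀ x ∈ V.fiber p, T x = U x)
    (h₂ : ∀ x ∈ V.perp p, T x = U x) : T = U := by
  ext x : 1
  obtain ⟨y, hy, z, hz, rfl⟩ :=
    Submodule.mem_sup.1 ((V.isCompl p).sup_eq_top.symm ▸ Submodule.mem_top : x ∈ V.fiber p ⊔ V.perp p)
  rw [map_add, map_add, h₁ y hy, h₂ z hz]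

theorem proj_add_projPerp (p : S) : V.proj p + V.projPerp p = 1 :=
  V.ext_fiber_perp (p := p)
    (fun x hx => by simp [V.proj_eq_self hx, V.projPerp_eq_zero hx])
    (fun x hx => by simp [V.proj_eq_zero hx, V.projPerp_eq_self hx])

theorem refl_apply_of_mem {p : S} {x : E n} (hx : x ∈ V.fiber p) : V.refl p x = x := by
  simp [refl, V.proj_eq_self hx, V.projPerp_eq_zero hx]

theorem refl_apply_of_mem_perp {p : S} {x : E n} (hx : x ∈ V.perp p) : V.refl p x = -x := by
  simp [refl, V.proj_eq_zero hx, V.projPerp_eq_self hx]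

theorem refl_mul_refl (p : S) : V.refl p * V.refl p = 1 :=
  V.ext_fiber_perp (p := p)
    (fun x hx => by simp [V.refl_apply_of_mem hx])
    (fun x hx => by simp [V.refl_apply_of_mem_perp hx])

theorem proj_eq (p : S) : V.proj p = (1 / 2 : ℂ) • (1 + V.refl p) := by
  rw [refl, ← V.proj_add_projPerp p]; module

theorem projPerp_eq (p : S) : V.projPerp p = (1 / 2 : ℂ) • (1 - V.refl p) := by
  rw [refl, ← V.proj_add_projPerp p]; module

theorem mem_fiber_iff {p : S} {x : E n} : x ∈ V.fiber p ↔ V.refl p x = x := by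
  refine ⟨V.refl_apply_of_mem, fun h => ?_⟩
  have : V.proj p x = x := by
    rw [V.proj_eq, smul_apply, add_apply, one_apply_eq_self, h]; module
  exact this ▸ V.proj_mem p x

theorem mem_perp_iff {p : S} {x : E n} : x ∈ V.perp p ↔ V.refl p x = -x := by
  refine ⟨V.refl_apply_of_mem_perp, fun h => ?_⟩
  have : V.projPerp p x = x := by
    rw [V.projPerp_eq, smul_apply, sub_apply, one_apply_eq_self, h]; module
  exact this ▸ V.projPerp_mem p x

theorem refl_orthogonal (p : S) : IsOrthogonal (V.refl p) := by
  intro x y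
  have hxy : ∀ u ∈ V.fiber p, ∀ w ∈ V.perp p, metric n u w = 0 := fun u hu w hw => hw u hu
  have hx := congrArg (fun T : EndE n => T x) (V.proj_add_projPerp p)
  have hy := congrArg (fun T : EndE n => T y) (V.proj_add_projPerp p)
  simp only [add_apply, one_apply_eq_self] at hx hy
  have h1 := hxy _ (V.proj_mem p x) _ (V.projPerp_mem p y)
  have h2 := hxy _ (V.proj_mem p y) _ (V.projPerp_mem p x)
  rw [metric_comm] at h2
  conv_rhs => rw [← hx, ← hy]
  simp [refl, h1, h2]

/-- `Ad_ρ (u ∧ v) = ρu ∧ ρv`. On `V` the reflection is the identity, and on `V^⊥` the two signs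
cancel, so `Ad_ρ` fixes both summands. -/
theorem refl_commutes {p : S} {X : EndE n} (hX : X ∈ wedgeSq (V.fiber p) ⊔ wedgeSq (V.perp p)) :
    X * V.refl p = V.refl p * X := by
  have hu := V.refl_mul_refl p
  have h : wedgeSq (V.fiber p) ⊔ wedgeSq (V.perp p) ≤ LinearMap.eqLocus
      (Ad (V.refl p)).toLinearMap LinearMap.id := by
    refine sup_le (Submodule.span_le.2 ?_) (Submodule.span_le.2 ?_)
    · rintro _ ⟨u, hu, v, hv, rfl⟩
      have := (V.refl_orthogonal p).Ad_wedge u v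
      rw [V.refl_apply_of_mem hu, V.refl_apply_of_mem hv] at this
      exact this
    · rintro _ ⟨u, hu, v, hv, rfl⟩
      have := (V.refl_orthogonal p).Ad_wedge u v
      rw [V.refl_apply_of_mem_perp hu, V.refl_apply_of_mem_perp hv] at this
      refine this.trans ?_
      ext w
      simp [wedge_apply]
  have h1 : V.refl p * X * Ring.inverse (V.refl p) = X := h hX
  conv_lhs => rw [← h1]
  rw [mul_assoc, (V.refl_orthogonal p).inverse_mul, mul_one]

end NondegSubbundle

section

variable {S : Type*} [TopologicalSpace S] [ChartedSpace ℂ S]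
variable {n : ℕ}

/-! ### Smoothness of inverses and projections -/

theorem ContMDiffOn.ringInverse {R : Type*} [NormedRing R] [NormedAlgebra ℂ R] [CompleteSpace R]
    {f : S → R} {U : Set S} (hf : ContMDiffOn 𝓘(ℝ, ℂ) 𝓘(ℝ, R) ∞ f U)
    (hu : ∀ p ∈ U, IsUnit (f p)) :
    ContMDiffOn 𝓘(ℝ, ℂ) 𝓘(ℝ, R) ∞ (fun p => Ring.inverse (f p)) U := fun p hp => by
  have h : ContDiffAt ℝ ∞ (Ring.inverse : R → R) (f p) := by
    obtain ⟨u, hu'⟩ := hu p hp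
    rw [← hu']
    exact contDiffAt_ringInverse ℝ u
  exact h.contMDiffAt.comp_contMDiffWithinAt p (hf p hp)

theorem Smooth.ringInverse {g : S → EndE n} (hg : Smooth g) (hu : ∀ p, IsUnit (g p)) :
    Smooth (fun p => Ring.inverse (g p)) :=
  contMDiffOn_univ.1 (ContMDiffOn.ringInverse (contMDiffOn_univ.2 hg) fun p _ => hu p)

theorem Smooth.apply {f : S → EndE n} {s : S → E n} (hf : Smooth f) (hs : Smooth s) :
    Smooth (fun p => f p (s p)) :=
  hf.bilinear (ContinuousLinearMap.id ℂ (EndE n)) hs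

theorem ContMDiffOn.clm {F G : Type*} [NormedAddCommGroup F] [NormedSpace ℂ F]
    [NormedAddCommGroup G] [NormedSpace ℂ G] (L : F →L[ℂ] G) {f : S → F} {U : Set S}
    (hf : ContMDiffOn 𝓘(ℝ, ℂ) 𝓘(ℝ, F) ∞ f U) :
    ContMDiffOn 𝓘(ℝ, ℂ) 𝓘(ℝ, G) ∞ (fun p => L (f p)) U :=
  ((L.restrictScalars ℝ).contDiff (n := ∞)).contMDiff.comp_contMDiffOn hf

namespace NondegSubbundle

variable (V : NondegSubbundle S n)

/-- In a local frame let `B` send coefficients to the section and let `C` pair a vector with the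
frame. Then `G = C B` is the Gram matrix, and the projection is `B G⁻¹ C`, a smooth expression. -/
theorem smooth_proj : Smooth V.proj := by
  intro p₀
  obtain ⟨U, hU, hp₀, k, s, hs, hspan⟩ := V.smooth p₀
  let B : S → (Fin k → ℂ) →L[ℂ] E n := fun p => ∑ i,
    ContinuousLinearMap.smulRightL ℂ (Fin k → ℂ) (E n) (ContinuousLinearMap.proj i) (s i p)
  let C : S → E n →L[ℂ] (Fin k → ℂ) := fun p => ∑ i,
    (ContinuousLinearMap.smulRightL ℂ (E n) (Fin k → ℂ)).flip (Pi.single i 1)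
      (metricCLM n (s i p))
  have hB : ContMDiffOn 𝓘(ℝ, ℂ) 𝓘(ℝ, (Fin k → ℂ) →L[ℂ] E n) ∞ B U :=
    contMDiffOn_finsetSum fun i _ => ContMDiffOn.clm _ (hs i)
  have hC : ContMDiffOn 𝓘(ℝ, ℂ) 𝓘(ℝ, E n →L[ℂ] (Fin k → ℂ)) ∞ C U :=
    contMDiffOn_finsetSum fun i _ => ContMDiffOn.clm _ (ContMDiffOn.clm _ (hs i))
  have hB' : ∀ p c, B p c = ∑ i, c i • s i p := fun p c => by
    simp [B]
  have hC' : ∀ p x i, C p x i = metric n (s i p) x := fun p x i => by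
    simp [C, metricCLM_apply, Pi.single_apply]
  have hmem : ∀ p ∈ U, ∀ i, s i p ∈ V.fiber p := fun p hp i => by
    rw [(hspan p hp).2]; exact Submodule.subset_span ⟨i, rfl⟩
  have hBmem : ∀ p ∈ U, ∀ c, B p c ∈ V.fiber p := fun p hp c => by
    rw [hB']; exact Submodule.sum_mem _ fun i _ => Submodule.smul_mem _ _ (hmem p hp i)
  have hperp : ∀ p ∈ U, ∀ x, C p x = 0 ↔ x ∈ V.perp p := fun p hp x => by
    constructor
    · intro h y hy
      have hle : V.fiber p ≤ LinearMap.ker ((metric n).flip x) := by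
        rw [(hspan p hp).2, Submodule.span_le]
        rintro _ ⟨i, rfl⟩
        have := congrFun h i
        rw [hC'] at this
        exact this
      exact hle hy
    · intro h
      funext i
      rw [hC']
      exact h _ (hmem p hp i)
  let G : S → (Fin k → ℂ) →L[ℂ] (Fin k → ℂ) := fun p =>
    ContinuousLinearMap.compL ℂ (Fin k → ℂ) (E n) (Fin k → ℂ) (C p) (B p)
  have hG : ContMDiffOn 𝓘(ℝ, ℂ) 𝓘(ℝ, (Fin k → ℂ) →L[ℂ] (Fin k → ℂ)) ∞ G U :=
    ContMDiffOn.bilinear _ hC hB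
  -- A vector in the kernel of the Gram matrix gives an element of `V ∩ V^⊥ = 0`.
  have hGu : ∀ p ∈ U, IsUnit (G p) := fun p hp => by
    have hinj : Function.Injective (G p) := by
      rw [injective_iff_map_eq_zero]
      intro c hc
      have h0 : B p c = 0 := by
        have := (V.isCompl p).disjoint.le_bot ⟨hBmem p hp c, (hperp p hp _).1 hc⟩
        simpa using this
      rw [hB'] at h0
      exact funext (Fintype.linearIndependent_iff.1 (hspan p hp).1 c h0)
    rw [ContinuousLinearMap.isUnit_iff_bijective]
    exact ⟨hinj, LinearMap.surjective_of_injective (f := (G p).toLinearMap) hinj⟩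
  have hGi := ContMDiffOn.ringInverse hG hGu
  have key : ContMDiffOn 𝓘(ℝ, ℂ) 𝓘(ℝ, EndE n) ∞
      (fun p => ContinuousLinearMap.compL ℂ (E n) (Fin k → ℂ) (E n) (B p)
        (ContinuousLinearMap.compL ℂ (E n) (Fin k → ℂ) (Fin k → ℂ) (Ring.inverse (G p)) (C p))) U :=
    ContMDiffOn.bilinear _ hB (ContMDiffOn.bilinear _ hGi hC)
  refine (key.congr fun p hp => ?_).contMDiffAt (hU.mem_nhds hp₀)
  refine V.ext_fiber_perp (p := p) (fun x hx => ?_) (fun x hx => ?_)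
  · rw [V.proj_eq_self hx]
    rw [(hspan p hp).2, Submodule.mem_span_range_iff_exists_fun] at hx
    obtain ⟨c, rfl⟩ := hx
    rw [← hB']
    have : Ring.inverse (G p) (G p c) = c :=
      congrArg (fun T : (Fin k → ℂ) →L[ℂ] (Fin k → ℂ) => T c)
        (Ring.inverse_mul_cancel (G p) (hGu p hp))
    exact (congrArg (B p) this).symm
  · rw [V.proj_eq_zero hx]
    simp [(hperp p hp x).2 hx]

theorem smooth_refl : Smooth V.refl := by
  have h : V.refl = fun p => (2 : ℂ) • V.proj p - 1 := by
    funext p; rw [V.proj_eq]; module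
  rw [h]
  exact (V.smooth_proj.clm ((2 : ℂ) • ContinuousLinearMap.id ℂ (EndE n))).sub (smooth_const 1)

theorem smooth_projPerp : Smooth V.projPerp := by
  have h : V.projPerp = fun p => 1 - V.proj p := by
    funext p; rw [← V.proj_add_projPerp p]; abel
  rw [h]
  exact (smooth_const 1).sub V.smooth_proj

end NondegSubbundle

/-! ### Connections and their forms -/

theorem Connection.op_apply (D : Connection S n) (s : S → E n) (p : S)
    (v : TangentSpace 𝓘(ℝ, ℂ) p) : D.op s p v = diff s p v + D.form p v (s p) := rfl

theorem Connection.op_const (D : Connection S n) (x : E n) (p : S)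
    (v : TangentSpace 𝓘(ℝ, ℂ) p) : D.op (fun _ => x) p v = D.form p v x := by
  rw [D.op_apply, diff_const]
  exact zero_add _

section

variable [IsManifold 𝓘(ℂ) 1 S]

theorem diff_apply {g : S → EndE n} {s : S → E n} (hg : Smooth g) (hs : Smooth s) (p : S)
    (v : TangentSpace 𝓘(ℝ, ℂ) p) :
    diff (fun x => g x (s x)) p v = diff g p v (s p) + g p (diff s p v) :=
  diff_bilinear (ContinuousLinearMap.id ℂ (EndE n)) hg hs p v

theorem diff_mul {f g : S → EndE n} (hf : Smooth f) (hg : Smooth g) (p : S)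
    (v : TangentSpace 𝓘(ℝ, ℂ) p) :
    diff (fun x => f x * g x) p v = diff f p v * g p + f p * diff g p v :=
  diff_bilinear (ContinuousLinearMap.mul ℂ (EndE n)) hf hg p v

theorem Connection.isMetric_iff (D : Connection S n) :
    D.IsMetric ↔ ∀ (p : S) (v : TangentSpace 𝓘(ℝ, ℂ) p) (x y : E n),
      metric n (D.form p v x) y + metric n x (D.form p v y) = 0 := by
  constructor
  · intro h p v x y
    have := h (fun _ => x) (fun _ => y) (smooth_const x) (smooth_const y) p v
    rw [D.op_const, D.op_const, diff_const] at this
    exact this.symm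
  · intro h s t hs ht p v
    have h1 := diff_bilinear (metricCLM n) hs ht p v
    simp only [metricCLM_apply] at h1
    rw [h1, D.op_apply, D.op_apply, map_add, map_add, LinearMap.add_apply]
    linear_combination -(h p v (s p) (t p))

end

/-- The form `A'` is obtained from the connection form `A` by gauging with `g`. -/
def GaugeRel (g : S → EndE n) (A A' : OneForm S (EndE n)) : Prop :=
  ∀ (p : S) (v : TangentSpace 𝓘(ℝ, ℂ) p), A' p v * g p = g p * A p v - diff g p v

theorem GaugeRel.curvature_eq [IsManifold 𝓘(ℂ) 1 S] {g : S → EndE n} {D D' : Connection S n}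
    (h : GaugeRel g D.form D'.form) (hg : Smooth g) (p₀ : S) {z : ℂ}
    (hz : z ∈ (extChartAt 𝓘(ℝ, ℂ) p₀).target) (v w : ℂ) :
    curvature (inChart D'.form p₀) z v w * g ((extChartAt 𝓘(ℝ, ℂ) p₀).symm z)
      = g ((extChartAt 𝓘(ℝ, ℂ) p₀).symm z) * curvature (inChart D.form p₀) z v w := by
  refine curvature_gauge (isOpen_chart_target p₀) (D.smooth p₀) (D'.smooth p₀)
    (hg.contDiffOn_chart p₀) (fun x hx u => ?_) hz v w
  rw [← inChart_diff hg p₀ hx]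
  exact h _ _

/-- The curvatures satisfy `F' g = g F` with `g` invertible. -/
theorem GaugeRel.isFlat_iff [IsManifold 𝓘(ℂ) 1 S] {g : S → EndE n} {D D' : Connection S n}
    (h : GaugeRel g D.form D'.form) (hg : Smooth g) (hu : ∀ p, IsUnit (g p)) :
    D.IsFlat ↔ D'.IsFlat := by
  refine forall₅_congr fun p₀ z hz v w => ?_
  have := h.curvature_eq hg p₀ hz v w
  change curvature (inChart D.form p₀) z v w = 0 ↔ curvature (inChart D'.form p₀) z v w = 0
  rw [← (hu _).mul_right_eq_zero, ← this, (hu _).mul_left_eq_zero]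

/-! ### Types of one-forms -/

section

variable {F : Type*} [NormedAddCommGroup F] [NormedSpace ℂ F]
variable {G : Type*} [NormedAddCommGroup G] [NormedSpace ℂ G]

theorem part10_apply (α : OneForm S F) (p : S) (v : TangentSpace 𝓘(ℝ, ℂ) p) :
    part10 α p v = (1 / 2 : ℂ) • (α p v - Complex.I • α p (J p v)) := rfl

theorem part01_apply (α : OneForm S F) (p : S) (v : TangentSpace 𝓘(ℝ, ℂ) p) :
    part01 α p v = (1 / 2 : ℂ) • (α p v + Complex.I • α p (J p v)) := rfl

theorem J_J (p : S) (v : TangentSpace 𝓘(ℝ, ℂ) p) : J p (J p v) = -v := by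
  have h : ∀ w : ℂ, Complex.I * (Complex.I * w) = -w := fun w => by
    rw [← mul_assoc, Complex.I_mul_I, neg_one_mul]
  exact h v

theorem part10_add_part01 (α : OneForm S F) : part10 α + part01 α = α := by
  funext p; ext v
  change part10 α p v + part01 α p v = α p v
  rw [part10_apply, part01_apply]; module

theorem part10_J (α : OneForm S F) (p : S) (v : TangentSpace 𝓘(ℝ, ℂ) p) :
    part10 α p (J p v) = Complex.I • part10 α p v := by
  simp only [part10_apply, J_J, map_neg, smul_sub, smul_smul, smul_neg]
  rw [mul_left_comm, Complex.I_mul_I]; module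

theorem part01_J (α : OneForm S F) (p : S) (v : TangentSpace 𝓘(ℝ, ℂ) p) :
    part01 α p (J p v) = -(Complex.I • part01 α p v) := by
  simp only [part01_apply, J_J, map_neg, smul_add, smul_smul, smul_neg]
  rw [mul_left_comm, Complex.I_mul_I]; module

theorem part10_eq_self {α : OneForm S F}
    (h : ∀ p (v : TangentSpace 𝓘(ℝ, ℂ) p), α p (J p v) = Complex.I • α p v) : part10 α = α := by
  funext p; ext v
  rw [part10_apply, h, smul_smul, Complex.I_mul_I]; module

theorem part01_eq_zero {α : OneForm S F}
    (h : ∀ p (v : TangentSpace 𝓘(ℝ, ℂ) p), α p (J p v) = Complex.I • α p v) : part01 α = 0 := by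
  funext p; ext v
  rw [part01_apply, h, smul_smul, Complex.I_mul_I]
  change _ = (0 : F); module

theorem part01_eq_self {α : OneForm S F}
    (h : ∀ p (v : TangentSpace 𝓘(ℝ, ℂ) p), α p (J p v) = -(Complex.I • α p v)) :
    part01 α = α := by
  funext p; ext v
  rw [part01_apply, h, smul_neg, smul_smul, Complex.I_mul_I]; module

theorem part10_eq_zero {α : OneForm S F}
    (h : ∀ p (v : TangentSpace 𝓘(ℝ, ℂ) p), α p (J p v) = -(Complex.I • α p v)) :
    part10 α = 0 := by
  funext p; ext v
  rw [part10_apply, h, smul_neg, smul_smul, Complex.I_mul_I]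
  change _ = (0 : F); module

theorem part10_add (α β : OneForm S F) : part10 (α + β) = part10 α + part10 β := by
  funext p; ext v
  change _ = part10 α p v + part10 β p v
  simp only [part10_apply, Pi.add_apply, add_apply]; module

theorem part01_add (α β : OneForm S F) : part01 (α + β) = part01 α + part01 β := by
  funext p; ext v
  change _ = part01 α p v + part01 β p v
  simp only [part01_apply, Pi.add_apply, add_apply]; module

end

end

/-! ### The connection form of the spectral family and its symmetries. -/

section

variable {S : Type*} [TopologicalSpace S] [ChartedSpace ℂ S]
variable {n : ℕ}

namespace NondegSubbundle

variable (V : NondegSubbundle S n)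

/-- The endomorphism-valued one-form `𝒩_V^∇ = (A - ρ A ρ - ρ dρ) / 2` for `∇ = d + A`. -/
def normalForm (A : OneForm S (EndE n)) : OneForm S (EndE n) := fun p => (1 / 2 : ℂ) • (A p
  - ((ContinuousLinearMap.mulLeftRight ℂ (EndE n) (V.refl p) (V.refl p)).restrictScalars ℝ).comp
      (A p)
  - ((ContinuousLinearMap.mul ℂ (EndE n) (V.refl p)).restrictScalars ℝ).comp (diff V.refl p))

theorem normalForm_apply (A : OneForm S (EndE n)) (p : S) (v : TangentSpace 𝓘(ℝ, ℂ) p) :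
    V.normalForm A p v = (1 / 2 : ℂ) •
      (A p v - V.refl p * A p v * V.refl p - V.refl p * diff V.refl p v) := rfl

/-- The connection form of `∇^{μ,q}_V` for `∇ = d + A`. -/
def familyForm (A q : OneForm S (EndE n)) (μ : ℂ) : OneForm S (EndE n) :=
  A + (μ⁻¹ - 1) • part10 (V.normalForm A) + (μ - 1) • part01 (V.normalForm A)
    + (μ⁻¹ ^ 2 - 1) • part10 q + (μ ^ 2 - 1) • part01 q

theorem familyForm_apply (A q : OneForm S (EndE n)) (μ : ℂ) (p : S)
    (v : TangentSpace 𝓘(ℝ, ℂ) p) :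
    V.familyForm A q μ p v = A p v + (μ⁻¹ - 1) • part10 (V.normalForm A) p v
      + (μ - 1) • part01 (V.normalForm A) p v
      + (μ⁻¹ ^ 2 - 1) • part10 q p v + (μ ^ 2 - 1) • part01 q p v := rfl

theorem familyForm_one (A q : OneForm S (EndE n)) : V.familyForm A q 1 = A := by
  simp [familyForm]

variable [IsManifold 𝓘(ℂ) 1 S]

/-- Differentiate `ρ² = 1`. -/
theorem diff_refl_mul (p : S) (v : TangentSpace 𝓘(ℝ, ℂ) p) :
    diff V.refl p v * V.refl p = -(V.refl p * diff V.refl p v) := by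
  have h := diff_mul V.smooth_refl V.smooth_refl p v
  simp only [V.refl_mul_refl, diff_const] at h
  exact eq_neg_of_add_eq_zero_left h.symm

theorem normalForm_mul_refl (A : OneForm S (EndE n)) (p : S) (v : TangentSpace 𝓘(ℝ, ℂ) p) :
    V.normalForm A p v * V.refl p = -(V.refl p * V.normalForm A p v) := by
  have h := V.refl_mul_refl p
  have h' := V.diff_refl_mul p v
  rw [normalForm_apply, smul_mul_assoc, mul_smul_comm, ← smul_neg]
  congr 1
  simp only [sub_mul, mul_sub, mul_assoc, h, h', mul_one]
  simp only [← mul_assoc, h, one_mul, mul_neg]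
  abel

/-- With the projections written as `(1 ± ρ)/2`, the algebraic part of `A` averages to `(A +
ρAρ)/2`, and the derivatives of the projections contribute `ρ dρ / 2`. -/
theorem parallelPart_apply (D : Connection S n) {s : S → E n} (hs : Smooth s) (p : S)
    (v : TangentSpace 𝓘(ℝ, ℂ) p) :
    V.parallelPart D s p v
      = diff s p v + (D.form p v - V.normalForm D.form p v) (s p) := by
  have h := V.refl_mul_refl p
  have h' : ∀ x, V.refl p (V.refl p x) = x := apply_apply_of_mul_eq_one h
  have hR := V.diff_refl_mul p v
  have e1 : diff V.proj p v = (1 / 2 : ℂ) • diff V.refl p v := by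
    have := diff_clm ((1 / 2 : ℂ) • ContinuousLinearMap.id ℂ (EndE n))
      ((smooth_const (S := S) (1 : EndE n)).add V.smooth_refl) p v
    rw [diff_add (smooth_const 1) V.smooth_refl, diff_const, zero_add] at this
    rw [← show _ = (1 / 2 : ℂ) • diff V.refl p v from this]
    congr 1
    congr 1
    funext x
    exact V.proj_eq x
  have e2 : diff V.projPerp p v = -((1 / 2 : ℂ) • diff V.refl p v) := by
    have := diff_add V.smooth_proj V.smooth_projPerp
    simp only [V.proj_add_projPerp, diff_const] at this
    have := congrArg (fun α : OneForm S (EndE n) => α p v) this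
    exact e1 ▸ (neg_eq_of_add_eq_zero_right this.symm).symm
  change V.proj p (D.op (fun x => V.proj x (s x)) p v)
    + V.projPerp p (D.op (fun x => V.projPerp x (s x)) p v) = _
  rw [D.op_apply, D.op_apply, diff_apply V.smooth_proj hs, diff_apply V.smooth_projPerp hs, e1, e2,
    V.proj_eq, V.projPerp_eq, normalForm_apply]
  simp only [smul_apply, add_apply, sub_apply, neg_apply, one_apply_eq_self, mul_apply_eq_comp,
    map_add, map_sub, map_smul, map_neg, h', smul_add, smul_sub]
  module

theorem normalPart_apply (D : Connection S n) {s : S → E n} (hs : Smooth s) (p : S)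
    (v : TangentSpace 𝓘(ℝ, ℂ) p) :
    V.normalPart D s p v = V.normalForm D.form p v (s p) := by
  change D.op s p v - V.parallelPart D s p v = _
  rw [V.parallelPart_apply D hs, D.op_apply, sub_apply]
  abel

theorem family_apply (D : Connection S n) (q : OneForm S (EndE n)) (μ : ℂ) {s : S → E n}
    (hs : Smooth s) (p : S) (v : TangentSpace 𝓘(ℝ, ℂ) p) :
    V.family D q μ s p v = diff s p v + V.familyForm D.form q μ p v (s p) := by
  change V.parallelPart D s p v
    + μ⁻¹ • part10 (V.normalPart D s) p v + μ • part01 (V.normalPart D s) p v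
    + ((μ⁻¹ ^ 2 - 1) • part10 q p v + (μ ^ 2 - 1) • part01 q p v) (s p) = _
  rw [familyForm_apply, V.parallelPart_apply D hs]
  simp only [part10_apply, part01_apply, V.normalPart_apply D hs, smul_apply, add_apply, sub_apply]
  module

/-- Constant sections recover the connection form, so equality of operators reduces to equality of
forms. -/
theorem represents_family_iff (D D' : Connection S n) (q : OneForm S (EndE n)) (μ : ℂ) :
    D'.Represents (V.family D q μ) ↔ D'.form = V.familyForm D.form q μ := by
  constructor
  · intro h
    funext p; ext v x
    have := congrArg (fun P : OneForm S (E n) => P p v) (h (fun _ => x) (smooth_const x))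
    simp only [D'.op_const, V.family_apply D q μ (smooth_const x), diff_const] at this
    exact this.symm.trans (zero_add _)
  · intro h s hs
    funext p; ext v : 1
    rw [V.family_apply D q μ hs, D'.op_apply, h]

theorem gaugeRel_of_represents {g : S → EndE n} (hg : Smooth g) (hu : ∀ p, IsUnit (g p))
    {D D' : Connection S n} {q : OneForm S (EndE n)} {μ : ℂ}
    (h : D'.Represents (gauge g (V.family D q μ))) :
    GaugeRel g (V.familyForm D.form q μ) D'.form := by
  intro p v
  ext x : 1
  -- The test section is `g x` with `x` constant: undoing the gauge returns a constant section, so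
  -- no derivative of `g⁻¹` appears.
  have hx := hg.apply (smooth_const x)
  have h1 := congrArg (fun P : OneForm S (E n) => P p v) (h _ hx)
  have h2 : (fun y => Ring.inverse (g y) (g y x)) = fun _ => x := by
    funext y
    exact apply_apply_of_mul_eq_one (Ring.inverse_mul_cancel _ (hu y)) x
  have h3 : gauge g (V.family D q μ) (fun y => g y x) p v
      = g p (V.family D q μ (fun y => Ring.inverse (g y) (g y x)) p v) := rfl
  simp only [h3, h2] at h1
  rw [V.family_apply D q μ (smooth_const x), diff_const, D'.op_apply,
    diff_apply hg (smooth_const x), diff_const] at h1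
  simp only [Pi.zero_apply, zero_apply, map_zero, add_zero, zero_add] at h1
  simp only [mul_apply_eq_comp, sub_apply]
  rw [h1]; abel

theorem normalForm_smooth {A : OneForm S (EndE n)} (hA : SmoothForm A) :
    SmoothForm (V.normalForm A) := by
  have h1 : SmoothForm fun p => ((ContinuousLinearMap.mul ℂ (EndE n) (V.refl p)).restrictScalars
      ℝ).comp (diff V.refl p) := V.smooth_refl.smoothForm_diff.bilinear _ V.smooth_refl
  have h2 := hA.bilinear (ContinuousLinearMap.mul ℂ (EndE n)) V.smooth_refl
  have h3 := h2.bilinear (ContinuousLinearMap.mul ℂ (EndE n)).flip V.smooth_refl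
  exact ((hA.sub h3).sub h1).smul (1 / 2)

theorem familyForm_smooth {A q : OneForm S (EndE n)} (hA : SmoothForm A) (hq : SmoothForm q)
    (μ : ℂ) : SmoothForm (V.familyForm A q μ) :=
  (((hA.add ((V.normalForm_smooth hA).part10.smul _)).add
    ((V.normalForm_smooth hA).part01.smul _)).add (hq.part10.smul _)).add (hq.part01.smul _)

/-- The symmetry behind the twisting condition: `ρ` gauges the family at `μ` into the family at
`-μ`. The normal form anticommutes with `ρ` and enters with odd powers of `μ`; `q` commutes with `ρ`
and enters with even powers. -/
theorem familyForm_neg_mul_refl {A q : OneForm S (EndE n)}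
    (hq : ∀ (p : S) (v : TangentSpace 𝓘(ℝ, ℂ) p), q p v * V.refl p = V.refl p * q p v)
    (μ : ℂ) (p : S) (v : TangentSpace 𝓘(ℝ, ℂ) p) :
    V.familyForm A q (-μ) p v * V.refl p
      = V.refl p * V.familyForm A q μ p v - diff V.refl p v := by
  have hN := V.normalForm_mul_refl A p
  have h := V.refl_mul_refl p
  have h10 : part10 (V.normalForm A) p v * V.refl p
      = -(V.refl p * part10 (V.normalForm A) p v) := by
    simp only [part10_apply, smul_mul_assoc, sub_mul, mul_smul_comm, mul_sub, hN]
    module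
  have h01 : part01 (V.normalForm A) p v * V.refl p
      = -(V.refl p * part01 (V.normalForm A) p v) := by
    simp only [part01_apply, smul_mul_assoc, add_mul, mul_smul_comm, mul_add, hN]
    module
  have q10 : part10 q p v * V.refl p = V.refl p * part10 q p v := by
    simp only [part10_apply, smul_mul_assoc, sub_mul, mul_smul_comm, mul_sub, hq]
  have q01 : part01 q p v * V.refl p = V.refl p * part01 q p v := by
    simp only [part01_apply, smul_mul_assoc, add_mul, mul_smul_comm, mul_add, hq]
  have hsum : part10 (V.normalForm A) p v + part01 (V.normalForm A) p v
      = (1 / 2 : ℂ) • (A p v - V.refl p * A p v * V.refl p - V.refl p * diff V.refl p v) :=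
    congrArg (fun α : OneForm S (EndE n) => α p v) (part10_add_part01 (V.normalForm A))
  have hA : A p v * V.refl p = V.refl p * A p v - diff V.refl p v
      - (2 : ℂ) • (V.refl p * (part10 (V.normalForm A) p v + part01 (V.normalForm A) p v)) := by
    rw [hsum, mul_smul_comm, smul_smul]
    simp only [mul_sub, ← mul_assoc, h, one_mul]
    module
  simp only [familyForm_apply, add_mul, mul_add, smul_mul_assoc, mul_smul_comm, h10, h01, q10, q01,
    hA, inv_neg, neg_sq]
  module

/-- Naturality: a gauge that carries `W` to `V`, `A` to `A'` and `q` to `q'` carries the whole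
spectral family along. The point is that normal parts are conjugated with no inhomogeneous term. -/
theorem gaugeRel_familyForm {W : NondegSubbundle S n} {g : S → EndE n} (hg : Smooth g)
    (hW : ∀ p, g p * W.refl p = V.refl p * g p) {A A' q q' : OneForm S (EndE n)}
    (hA : GaugeRel g A A')
    (hq : ∀ (p : S) (v : TangentSpace 𝓘(ℝ, ℂ) p), q' p v * g p = g p * q p v) (μ : ℂ) :
    GaugeRel g (W.familyForm A q μ) (V.familyForm A' q' μ) := by
  intro p v
  have hN : ∀ v : TangentSpace 𝓘(ℝ, ℂ) p,
      V.normalForm A' p v * g p = g p * W.normalForm A p v := by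
    intro v
    have h1 := diff_mul hg W.smooth_refl p v
    have h2 := diff_mul V.smooth_refl hg p v
    simp only [hW] at h1
    rw [h1] at h2
    have h3 := eq_sub_of_add_eq' h2
    have hgA : g p * A p v = A' p v * g p + diff g p v := by rw [hA p v]; abel
    rw [normalForm_apply, normalForm_apply, smul_mul_assoc, mul_smul_comm]
    congr 1
    have e1 : g p * (W.refl p * A p v * W.refl p)
        = V.refl p * A' p v * V.refl p * g p + V.refl p * diff g p v * W.refl p := by
      rw [← mul_assoc, ← mul_assoc, hW, mul_assoc (V.refl p), hgA, mul_add, add_mul]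
      simp only [mul_assoc, hW]
    have e2 : g p * (W.refl p * diff W.refl p v)
        = V.refl p * diff V.refl p v * g p + diff g p v - V.refl p * diff g p v * W.refl p := by
      rw [← mul_assoc, hW, mul_assoc, h3, mul_sub, mul_add]
      simp only [← mul_assoc, V.refl_mul_refl, one_mul]
    rw [mul_sub, mul_sub, e1, e2, hgA, sub_mul, sub_mul]
    abel
  simp only [familyForm_apply, add_mul, mul_add, smul_mul_assoc, mul_smul_comm, part10_apply,
    part01_apply, sub_mul, mul_sub, hN, hq, hA p v]
  abel

end NondegSubbundle

end

/-! ### A Liouville theorem -/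

theorem tendsto_inv_cocompact : Tendsto (fun μ : ℂ => μ⁻¹) (cocompact ℂ) (𝓝 0) :=
  Metric.cobounded_eq_cocompact (α := ℂ) ▸ tendsto_inv₀_cobounded

theorem eventually_ne_zero_cocompact : ∀ᶠ μ : ℂ in cocompact ℂ, μ ≠ 0 :=
  (isCompact_singleton (x := (0 : ℂ))).compl_mem_cocompact

/-- After removing the singularity at `0`, two divided differences at `0` leave an entire function
tending to `L` at infinity, constant by Liouville. The linear coefficient is written as the odd part
of `f` at `1`, the form in which the twisting condition determines it. -/
theorem eq_quadratic_of_tendsto {G : Type*} [NormedAddCommGroup G] [NormedSpace ℂ G]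
    [CompleteSpace G] {f : ℂ → G} {c L : G} (hf : DifferentiableOn ℂ f {0}ᶜ)
    (h0 : Tendsto f (𝓝[≠] 0) (𝓝 c))
    (hinf : Tendsto (fun μ : ℂ => μ⁻¹ ^ 2 • f μ) (cocompact ℂ) (𝓝 L)) {μ : ℂ} (hμ : μ ≠ 0) :
    f μ = c + μ • ((1 / 2 : ℂ) • (f 1 - f (-1))) + μ ^ 2 • L := by
  set g : ℂ → G := Function.update f 0 c with hg
  have hgf : ∀ μ ≠ 0, g μ = f μ := fun μ hμ => Function.update_of_ne hμ _ _
  have hg0 : g 0 = c := Function.update_self _ _ _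
  have dg : DifferentiableOn ℂ g Set.univ := by
    rw [← Complex.differentiableOn_compl_singleton_and_continuousAt_iff (c := 0) univ_mem]
    refine ⟨(hf.congr fun x hx => hgf x hx).mono fun x hx => hx.2, ?_⟩
    exact continuousAt_update_same.2 h0
  have dk1 : DifferentiableOn ℂ (dslope g 0) Set.univ :=
    (Complex.differentiableOn_dslope univ_mem).2 dg
  have dk2 : DifferentiableOn ℂ (dslope (dslope g 0) 0) Set.univ :=
    (Complex.differentiableOn_dslope univ_mem).2 dk1
  have e1 : ∀ μ, g μ = c + μ • dslope g 0 μ := fun μ => by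
    have := sub_smul_dslope g 0 μ
    rw [hg0, sub_zero] at this
    rw [this]; abel
  have e2 : ∀ μ, dslope g 0 μ = dslope g 0 0 + μ • dslope (dslope g 0) 0 μ := fun μ => by
    have := sub_smul_dslope (dslope g 0) 0 μ
    rw [sub_zero] at this
    rw [this]; abel
  have hlim : Tendsto (dslope (dslope g 0) 0) (cocompact ℂ) (𝓝 L) := by
    have hinv := tendsto_inv_cocompact
    have h1 : Tendsto (fun μ : ℂ => μ⁻¹ ^ 2 • f μ - μ⁻¹ ^ 2 • c - μ⁻¹ • dslope g 0 0) (cocompact ℂ)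
        (𝓝 (L - (0 : ℂ) ^ 2 • c - (0 : ℂ) • dslope g 0 0)) :=
      (hinf.sub ((hinv.pow 2).smul_const c)).sub (hinv.smul_const _)
    simp only [ne_eq, OfNat.ofNat_ne_zero, not_false_eq_true, zero_pow, zero_smul, sub_zero] at h1
    refine h1.congr' ?_
    filter_upwards [eventually_ne_zero_cocompact] with μ hμ
    rw [← hgf μ hμ, e1, e2]
    simp only [smul_add, smul_smul]
    rw [show μ⁻¹ ^ 2 * μ = μ⁻¹ by field_simp,
      show μ⁻¹ ^ 2 * (μ * μ) = 1 by field_simp, one_smul]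
    abel
  have hk : ∀ μ, dslope (dslope g 0) 0 μ = L := fun μ =>
    (differentiableOn_univ.1 dk2).apply_eq_of_tendsto_cocompact μ hlim
  have main : ∀ μ ≠ 0, f μ = c + μ • (dslope g 0 0) + μ ^ 2 • L := fun μ hμ => by
    rw [← hgf μ hμ, e1, e2, hk]
    module
  rw [main μ hμ, main 1 one_ne_zero, main (-1) (neg_ne_zero.2 one_ne_zero)]
  module

/-! ### Vector-valued rational functions -/

section Ratio

variable {G : Type*} [NormedAddCommGroup G] [NormedSpace ℂ G]

/-- The rational function `(a₀ + μ a₁ + ⋯ + μ^N a_N) / Q(μ)`. -/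
def ratio (Q : Polynomial ℂ) (N : ℕ) (a : ℕ → G) (μ : ℂ) : G :=
  (Q.eval μ)⁻¹ • ∑ i ∈ Finset.range (N + 1), μ ^ i • a i

/-- The leading coefficient of `(a₀ + μ a₁ + ⋯ + μ^N a_N) / Q(μ)` at infinity. -/
def leadingRatio (Q : Polynomial ℂ) (N : ℕ) (a : ℕ → G) : G :=
  ∑ i ∈ Finset.range (N + 1), (if i = Q.natDegree then Q.leadingCoeff⁻¹ else 0) • a i

theorem tendsto_ratio (Q : Polynomial ℂ) (N : ℕ) (a : ℕ → G) {μ₀ : ℂ} (h : Q.eval μ₀ ≠ 0) :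
    Tendsto (ratio Q N a) (𝓝 μ₀) (𝓝 (ratio Q N a μ₀)) :=
  (Q.continuous.continuousAt.inv₀ h).smul
    (tendsto_finsetSum _ fun i _ => ((continuous_pow i).smul continuous_const).continuousAt)

/-- Moves behaviour at infinity to `0`, where the reversed polynomial takes the leading coefficient
of `Q` as its value. -/
theorem eval_eq_pow_mul_reverse (Q : Polynomial ℂ) {μ : ℂ} (hμ : μ ≠ 0) :
    Q.eval μ = μ ^ Q.natDegree * Q.reverse.eval μ⁻¹ := by
  let _ := invertibleOfNonzero hμ
  have := Polynomial.eval₂_reverse_mul_pow (RingHom.id ℂ) μ Q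
  rw [invOf_eq_inv] at this
  rw [Polynomial.eval, ← this, mul_comm]
  rfl

theorem tendsto_reverse_eval (Q : Polynomial ℂ) :
    Tendsto (fun μ : ℂ => Q.reverse.eval μ⁻¹) (cocompact ℂ) (𝓝 Q.leadingCoeff) := by
  have h := (Q.reverse.continuous.tendsto 0).comp tendsto_inv_cocompact
  rwa [← Polynomial.coeff_zero_eq_eval_zero, Polynomial.coeff_zero_reverse] at h

theorem tendsto_ratio_cocompact {Q : Polynomial ℂ} (hQ : Q ≠ 0) (N : ℕ) {a : ℕ → G}
    (ha : ∀ i ∈ Finset.range (N + 1), Q.natDegree < i → a i = 0) :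
    Tendsto (ratio Q N a) (cocompact ℂ) (𝓝 (leadingRatio Q N a)) := by
  have hlc : Q.leadingCoeff ≠ 0 := Polynomial.leadingCoeff_ne_zero.2 hQ
  have h : Tendsto (fun μ : ℂ => ∑ i ∈ Finset.range (N + 1), ((Q.eval μ)⁻¹ * μ ^ i) • a i)
      (cocompact ℂ) (𝓝 (leadingRatio Q N a)) := by
    refine tendsto_finsetSum _ fun i hi => ?_
    rcases lt_or_ge Q.natDegree i with hlt | hle
    · rw [ha i hi hlt]; simp
    · refine Tendsto.smul_const ?_ _
      have h1 := (tendsto_inv_cocompact.pow (Q.natDegree - i)).mul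
        ((tendsto_reverse_eval Q).inv₀ hlc)
      -- By `0 ^ 0 = 1`, only the term of index `deg Q` survives.
      have h2 : (0 : ℂ) ^ (Q.natDegree - i) * Q.leadingCoeff⁻¹
          = if i = Q.natDegree then Q.leadingCoeff⁻¹ else 0 := by
        split_ifs with h
        · simp [h]
        · rw [zero_pow (by omega), zero_mul]
      rw [h2] at h1
      refine h1.congr' ?_
      filter_upwards [eventually_ne_zero_cocompact] with μ hμ
      rw [eval_eq_pow_mul_reverse Q hμ, mul_inv, inv_pow, ← Nat.sub_add_cancel hle, pow_add,
        Nat.add_sub_cancel, mul_inv]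
      field_simp
  refine h.congr fun μ => ?_
  rw [ratio, Finset.smul_sum]
  simp only [smul_smul]

/-- If `M > deg Q` is the largest index with `a M ≠ 0`, then `μ⁻ᴹ Q(μ)` times the ratio tends to
`0`, since `μ⁻ᴹ Q(μ)` does and the ratio converges. The same product is `μ⁻ᴹ` times the numerator,
which tends to `a M`. -/
theorem eq_zero_of_tendsto_ratio {Q : Polynomial ℂ} {N : ℕ} {a : ℕ → G} {L : G}
    (hQ : ∀ᶠ μ in cocompact ℂ, Q.eval μ ≠ 0)
    (h : Tendsto (ratio Q N a) (cocompact ℂ) (𝓝 L)) :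
    ∀ i ∈ Finset.range (N + 1), Q.natDegree < i → a i = 0 := by
  by_contra! hne
  obtain ⟨i₀, hi₀, hd₀, ha₀⟩ := hne
  classical
  obtain ⟨M, hM, hmax⟩ := Finset.exists_max_image
    ((Finset.range (N + 1)).filter fun i => Q.natDegree < i ∧ a i ≠ 0) id
    ⟨i₀, Finset.mem_filter.2 ⟨hi₀, hd₀, ha₀⟩⟩
  obtain ⟨hMN, hdM, haM⟩ := Finset.mem_filter.1 hM
  have h1 : Tendsto (fun μ : ℂ => (μ⁻¹ ^ M * Q.eval μ) • ratio Q N a μ) (cocompact ℂ) (𝓝 0) := by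
    have h2 := ((tendsto_inv_cocompact.pow (M - Q.natDegree)).mul
      (tendsto_reverse_eval Q)).smul h
    rw [zero_pow (by omega), zero_mul, zero_smul] at h2
    refine h2.congr' ?_
    filter_upwards [eventually_ne_zero_cocompact] with μ hμ
    congr 1
    conv_rhs => rw [eval_eq_pow_mul_reverse Q hμ, ← Nat.sub_add_cancel hdM.le, pow_add]
    rw [mul_assoc, ← mul_assoc (μ⁻¹ ^ _) (μ ^ _), ← mul_pow, inv_mul_cancel₀ hμ, one_pow, one_mul]
  have h2 : Tendsto (fun μ : ℂ => ∑ i ∈ Finset.range (N + 1), (μ⁻¹ ^ M * μ ^ i) • a i)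
      (cocompact ℂ) (𝓝 (∑ i ∈ Finset.range (N + 1), if i = M then a i else 0)) := by
    refine tendsto_finsetSum _ fun i hi => ?_
    rcases lt_trichotomy i M with hlt | rfl | hgt
    · rw [if_neg hlt.ne]
      have h3 := (tendsto_inv_cocompact.pow (M - i)).smul_const (a i)
      rw [zero_pow (by omega), zero_smul] at h3
      refine h3.congr' ?_
      filter_upwards [eventually_ne_zero_cocompact] with μ hμ
      conv_rhs => rw [← Nat.sub_add_cancel hlt.le, pow_add]
      rw [mul_assoc, ← mul_pow, inv_mul_cancel₀ hμ, one_pow, mul_one]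
    · rw [if_pos rfl]
      refine tendsto_const_nhds.congr' ?_
      filter_upwards [eventually_ne_zero_cocompact] with μ hμ
      rw [← mul_pow, inv_mul_cancel₀ hμ, one_pow, one_smul]
    · have : a i = 0 := by
        by_contra hai
        have := hmax i (Finset.mem_filter.2 ⟨hi, hdM.trans hgt, hai⟩)
        exact absurd this (not_le.2 hgt)
      simp [this]
  rw [Finset.sum_ite_eq' _ M, if_pos hMN] at h2
  refine haM (tendsto_nhds_unique h2 (h1.congr' ?_))
  filter_upwards [hQ] with μ hμ
  rw [ratio, smul_smul, mul_assoc, mul_inv_cancel₀ hμ, mul_one, Finset.smul_sum]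
  simp only [smul_smul]

end Ratio

/-! ### Rational families of endomorphism fields: smoothness and limits of their differentials. -/

section

variable {S : Type*} [TopologicalSpace S] [ChartedSpace ℂ S]
variable {n : ℕ}

theorem Smooth.sum_smul (N : ℕ) (c : ℕ → ℂ) {a : ℕ → S → EndE n} (ha : ∀ i, Smooth (a i)) :
    Smooth (fun p => ∑ i ∈ Finset.range N, c i • a i p) := by
  induction N with
  | zero => simpa using smooth_const (0 : EndE n)
  | succ N ih =>
    simp only [Finset.sum_range_succ]
    exact ih.add ((ha N).clm (c N • ContinuousLinearMap.id ℂ (EndE n)))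

theorem diff_sum_smul [IsManifold 𝓘(ℂ) 1 S] (N : ℕ) (c : ℕ → ℂ) {a : ℕ → S → EndE n}
    (ha : ∀ i, Smooth (a i)) (p : S) (v : TangentSpace 𝓘(ℝ, ℂ) p) :
    diff (fun p => ∑ i ∈ Finset.range N, c i • a i p) p v
      = ∑ i ∈ Finset.range N, c i • diff (a i) p v := by
  induction N with
  | zero =>
    simp only [Finset.range_zero, Finset.sum_empty, diff_const]
    rfl
  | succ N ih =>
    simp only [Finset.sum_range_succ]
    have h := (ha N).clm (c N • ContinuousLinearMap.id ℂ (EndE n))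
    have h' := diff_clm (c N • ContinuousLinearMap.id ℂ (EndE n)) (ha N) p v
    have h2 := congrArg (fun α : OneForm S (EndE n) => α p v)
      (diff_add (Smooth.sum_smul N c ha) h)
    refine h2.trans ?_
    rw [← ih]
    exact congrArg₂ HAdd.hAdd rfl h'

namespace RationalFamily

variable (r : RationalFamily S n)

theorem eventually_mem_dom (μ₀ : ℂ) : ∀ᶠ μ in 𝓝[≠] μ₀, μ ∈ r.dom := by
  have h : {μ : ℂ | r.den.eval μ = 0}.Finite := by
    refine (r.den.roots.toFinset.finite_toSet).subset fun μ hμ => ?_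
    simpa [r.den_ne_zero] using hμ
  have h2 : ({μ : ℂ | r.den.eval μ = 0} \ {μ₀})ᶜ ∈ 𝓝 μ₀ :=
    (h.subset Set.sdiff_subset).isClosed.isOpen_compl.mem_nhds fun h => h.2 rfl
  filter_upwards [mem_nhdsWithin_of_mem_nhds h2, self_mem_nhdsWithin] with μ h1 h3 h4
  exact h1 ⟨h4, h3⟩

theorem eventually_mem_dom_cocompact : ∀ᶠ μ in cocompact ℂ, μ ∈ r.dom := by
  have h : {μ : ℂ | r.den.eval μ = 0}.Finite := by
    refine (r.den.roots.toFinset.finite_toSet).subset fun μ hμ => ?_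
    simpa [r.den_ne_zero] using hμ
  exact h.isCompact.compl_mem_cocompact

theorem val_eq_sum (μ : ℂ) :
    r.val μ = fun p => ∑ i ∈ Finset.range (r.deg + 1), ((r.den.eval μ)⁻¹ * μ ^ i) • r.num i p := by
  funext p
  rw [val, Finset.smul_sum]
  simp only [smul_smul]

theorem smooth_val (μ : ℂ) : Smooth (r.val μ) := by
  rw [val_eq_sum]
  exact Smooth.sum_smul _ _ r.smooth

theorem diff_val [IsManifold 𝓘(ℂ) 1 S] (μ : ℂ) (p : S) (v : TangentSpace 𝓘(ℝ, ℂ) p) :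
    diff (r.val μ) p v = ratio r.den r.deg (fun i => diff (r.num i) p v) μ := by
  rw [val_eq_sum, diff_sum_smul _ _ r.smooth, ratio, Finset.smul_sum]
  simp only [smul_smul]

variable {r} {r_inf : S → EndE n}

theorem HolomorphicAtInfinity.num_eq_zero (h : r.HolomorphicAtInfinity r_inf) (p : S) :
    ∀ i ∈ Finset.range (r.deg + 1), r.den.natDegree < i → r.num i p = 0 :=
  eq_zero_of_tendsto_ratio r.eventually_mem_dom_cocompact (h p)

theorem HolomorphicAtInfinity.eq_leadingRatio (h : r.HolomorphicAtInfinity r_inf) :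
    r_inf = fun p => leadingRatio r.den r.deg fun i => r.num i p :=
  funext fun p => tendsto_nhds_unique (h p)
    (tendsto_ratio_cocompact r.den_ne_zero _ (h.num_eq_zero p))

theorem HolomorphicAtInfinity.smooth (h : r.HolomorphicAtInfinity r_inf) : Smooth r_inf := by
  rw [h.eq_leadingRatio]
  exact Smooth.sum_smul _ _ r.smooth

/-- Only pointwise convergence at infinity is assumed. Rationality upgrades it to convergence of
first derivatives: the numerator coefficients of index above the degree of the denominator vanish,
so the limit is a fixed combination of smooth coefficients. -/
theorem HolomorphicAtInfinity.tendsto_diff [IsManifold 𝓘(ℂ) 1 S]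
    (h : r.HolomorphicAtInfinity r_inf) (p : S) (v : TangentSpace 𝓘(ℝ, ℂ) p) :
    Tendsto (fun μ => diff (r.val μ) p v) (cocompact ℂ) (𝓝 (diff r_inf p v)) := by
  have h1 : diff r_inf p v = leadingRatio r.den r.deg fun i => diff (r.num i) p v := by
    rw [h.eq_leadingRatio]
    exact diff_sum_smul _ _ r.smooth p v
  simp only [diff_val, h1]
  refine tendsto_ratio_cocompact r.den_ne_zero _ fun i hi hd => ?_
  -- The coefficient vanishes at every point of the surface, hence so does its differential.
  have : r.num i = fun _ => 0 := funext fun p => h.num_eq_zero p i hi hd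
  rw [this, diff_const]
  rfl

theorem tendsto_val {μ₀ : ℂ} (h : μ₀ ∈ r.dom) (p : S) :
    Tendsto (fun μ => r.val μ p) (𝓝 μ₀) (𝓝 (r.val μ₀ p)) :=
  tendsto_ratio r.den r.deg (fun i => r.num i p) h

theorem tendsto_diff_val [IsManifold 𝓘(ℂ) 1 S] {μ₀ : ℂ} (h : μ₀ ∈ r.dom) (p : S)
    (v : TangentSpace 𝓘(ℝ, ℂ) p) :
    Tendsto (fun μ => diff (r.val μ) p v) (𝓝 μ₀) (𝓝 (diff (r.val μ₀) p v)) := by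
  simp only [diff_val]
  exact tendsto_ratio r.den r.deg _ h

end RationalFamily

/-- Solves the gauge relation for `X` and passes to the limit. It serves for both types of form, at
`0` and at `∞`; the scalars `a`, `b`, `e` allow a prior rescaling by a power of `μ`. -/
theorem tendsto_of_gauge_eq {l : Filter ℂ} {R X D : ℂ → EndE n} {a b e : ℂ → ℂ}
    {R₀ N q D₀ : EndE n} {a₀ b₀ e₀ : ℂ} (hR : Tendsto R l (𝓝 R₀)) (hu : ∀ᶠ μ in l, IsUnit (R μ))
    (hR₀ : IsUnit R₀) (hD : Tendsto D l (𝓝 D₀)) (ha : Tendsto a l (𝓝 a₀))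
    (hb : Tendsto b l (𝓝 b₀)) (he : Tendsto e l (𝓝 e₀))
    (h : ∀ᶠ μ in l, X μ * R μ = R μ * (a μ • N + b μ • q) - e μ • D μ) :
    Tendsto X l (𝓝 ((R₀ * (a₀ • N + b₀ • q) - e₀ • D₀) * Ring.inverse R₀)) := by
  have hinv : Tendsto (fun μ => Ring.inverse (R μ)) l (𝓝 (Ring.inverse R₀)) := by
    obtain ⟨u, rfl⟩ := hR₀
    exact (NormedRing.inverse_continuousAt u).tendsto.comp hR
  have h1 := ((hR.mul ((ha.smul_const N).add (hb.smul_const q))).sub (he.smul hD)).mul hinv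
  refine h1.congr' ?_
  filter_upwards [h, hu] with μ hμ hμu
  rw [← hμ, mul_assoc, Ring.mul_inverse_cancel _ hμu, mul_one]

end

section

variable {S : Type*} [TopologicalSpace S] [ChartedSpace ℂ S]
variable {n : ℕ}

/-! ### The dressed form -/

theorem adForm_apply (T : S → EndE n) (q : OneForm S (EndE n)) (p : S)
    (v : TangentSpace 𝓘(ℝ, ℂ) p) : adForm T q p v = T p * q p v * Ring.inverse (T p) := rfl

/-- `Ad_T` is complex linear and so preserves types. -/
theorem part10_dressedForm (T₀ T₁ : S → EndE n) (q : OneForm S (EndE n)) :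
    part10 (dressedForm T₀ T₁ q) = adForm T₀ (part10 q) := by
  rw [dressedForm, part10_add, part10_eq_self (α := adForm T₀ _),
    part10_eq_zero (α := adForm T₁ _), add_zero]
  · intro p v
    rw [adForm_apply, adForm_apply, part01_J, mul_neg, neg_mul, mul_smul_comm, smul_mul_assoc]
  · intro p v
    rw [adForm_apply, adForm_apply, part10_J, mul_smul_comm, smul_mul_assoc]

theorem part01_dressedForm (T₀ T₁ : S → EndE n) (q : OneForm S (EndE n)) :
    part01 (dressedForm T₀ T₁ q) = adForm T₁ (part01 q) := by
  rw [dressedForm, part01_add, part01_eq_zero (α := adForm T₀ _),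
    part01_eq_self (α := adForm T₁ _), zero_add]
  · intro p v
    rw [adForm_apply, adForm_apply, part01_J, mul_neg, neg_mul, mul_smul_comm, smul_mul_assoc]
  · intro p v
    rw [adForm_apply, adForm_apply, part10_J, mul_smul_comm, smul_mul_assoc]

theorem SmoothForm.adForm [IsManifold 𝓘(ℂ) 1 S] {T : S → EndE n} {q : OneForm S (EndE n)}
    (hq : SmoothForm q) (hT : Smooth T) (hu : ∀ p, IsUnit (T p)) : SmoothForm (adForm T q) :=
  (hq.bilinear (ContinuousLinearMap.mul ℂ (EndE n)) hT).bilinear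
    (ContinuousLinearMap.mul ℂ (EndE n)).flip (hT.ringInverse hu)

namespace NondegSubbundle

variable (V : NondegSubbundle S n)

theorem apply_mem_of_commute {T : EndE n} {p : S} (h : V.refl p * T * V.refl p = T) {x : E n} :
    (x ∈ V.fiber p → T x ∈ V.fiber p) ∧ (x ∈ V.perp p → T x ∈ V.perp p) := by
  have h' : V.refl p * T = T * V.refl p := by
    conv_rhs => rw [← h]
    rw [mul_assoc _ (V.refl p) (V.refl p), V.refl_mul_refl, mul_one]
  have hx : V.refl p (T x) = T (V.refl p x) := congrArg (fun X : EndE n => X x) h'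
  refine ⟨fun hm => ?_, fun hm => ?_⟩
  · rw [mem_fiber_iff, hx, V.refl_apply_of_mem hm]
  · rw [mem_perp_iff, hx, V.refl_apply_of_mem_perp hm, map_neg]

/-- The image of a non-degenerate subbundle under a field of orthogonal endomorphisms. -/
def map (T : S → EndE n) (hs : Smooth T) (hT : ∀ p, IsOrthogonal (T p)) : NondegSubbundle S n where
  fiber p := (V.fiber p).map (T p).toLinearMap
  nondeg p := by
    have h := V.nondeg p
    refine ⟨?_, ?_⟩
    · rintro ⟨_, x, hx, rfl⟩ hy
      have := h.1 ⟨x, hx⟩ fun y => (hT p x y.1).symm.trans (hy ⟨T p y, y.1, y.2, rfl⟩)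
      have hx0 : x = 0 := congrArg Subtype.val this
      exact Subtype.ext (by simp [hx0])
    · rintro ⟨_, x, hx, rfl⟩ hy
      have := h.2 ⟨x, hx⟩ fun y => (hT p y.1 x).symm.trans (hy ⟨T p y, y.1, y.2, rfl⟩)
      have hx0 : x = 0 := congrArg Subtype.val this
      exact Subtype.ext (by simp [hx0])
  smooth p₀ := by
    obtain ⟨U, hU, hp₀, k, s, hss, hspan⟩ := V.smooth p₀
    refine ⟨U, hU, hp₀, k, fun i p => T p (s i p), fun i =>
      ContMDiffOn.bilinear (ContinuousLinearMap.id ℂ (EndE n)) (ContMDiff.contMDiffOn hs) (hss i),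
      fun p hp => ⟨?_, ?_⟩⟩
    · refine (hspan p hp).1.map' (T p).toLinearMap (LinearMap.ker_eq_bot.2 ?_)
      exact Function.LeftInverse.injective (apply_apply_of_mul_eq_one (hT p).inverse_mul)
    · rw [(hspan p hp).2, Submodule.map_span, ← Set.range_comp]
      rfl

theorem map_perp (T : S → EndE n) (hs : Smooth T) (hT : ∀ p, IsOrthogonal (T p)) {p : S} {x : E n}
    (hx : x ∈ V.perp p) : T p x ∈ (V.map T hs hT).perp p := by
  rintro _ ⟨y, hy, rfl⟩
  exact (hT p y x).trans (hx y hy)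

theorem map_refl (T : S → EndE n) (hs : Smooth T) (hT : ∀ p, IsOrthogonal (T p)) (p : S) :
    (V.map T hs hT).refl p * T p = T p * V.refl p := by
  refine V.ext_fiber_perp (p := p) (fun x hx => ?_) (fun x hx => ?_)
  · rw [mul_apply_eq_comp, mul_apply_eq_comp, V.refl_apply_of_mem hx]
    exact (V.map T hs hT).refl_apply_of_mem (Submodule.mem_map_of_mem hx)
  · rw [mul_apply_eq_comp, mul_apply_eq_comp, V.refl_apply_of_mem_perp hx, map_neg]
    exact (V.map T hs hT).refl_apply_of_mem_perp (V.map_perp T hs hT hx)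

theorem adForm_mem (q : OneForm S (EndE n)) {T : S → EndE n} (hs : Smooth T)
    (hT : ∀ p, IsOrthogonal (T p)) {p : S} {v : TangentSpace 𝓘(ℝ, ℂ) p}
    (hq : q p v ∈ wedgeSq (V.fiber p) ⊔ wedgeSq (V.perp p)) :
    adForm T q p v ∈ wedgeSq ((V.map T hs hT).fiber p) ⊔ wedgeSq ((V.map T hs hT).perp p) :=
  (hT p).Ad_mem_sup (fun _ hx => Submodule.mem_map_of_mem hx) (fun _ hx => V.map_perp T hs hT hx) hq

theorem dressedForm_mem {T₀ T₁ : S → EndE n} {q : OneForm S (EndE n)}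
    (h₀ : ∀ p, IsOrthogonal (T₀ p)) (h₁ : ∀ p, IsOrthogonal (T₁ p))
    (c₀ : ∀ p, V.refl p * T₀ p * V.refl p = T₀ p) (c₁ : ∀ p, V.refl p * T₁ p * V.refl p = T₁ p)
    (hq : ∀ (p : S) (v : TangentSpace 𝓘(ℝ, ℂ) p),
      q p v ∈ wedgeSq (V.fiber p) ⊔ wedgeSq (V.perp p)) (p : S) (v : TangentSpace 𝓘(ℝ, ℂ) p) :
    dressedForm T₀ T₁ q p v ∈ wedgeSq (V.fiber p) ⊔ wedgeSq (V.perp p) := by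
  refine Submodule.add_mem _ ?_ ?_
  · refine (h₀ p).Ad_mem_sup (fun x hx => (V.apply_mem_of_commute (c₀ p)).1 hx)
      (fun x hx => (V.apply_mem_of_commute (c₀ p)).2 hx) ?_
    exact Submodule.smul_mem _ _ (Submodule.sub_mem _ (hq p v) (Submodule.smul_mem _ _ (hq p _)))
  · refine (h₁ p).Ad_mem_sup (fun x hx => (V.apply_mem_of_commute (c₁ p)).1 hx)
      (fun x hx => (V.apply_mem_of_commute (c₁ p)).2 hx) ?_
    exact Submodule.smul_mem _ _ (Submodule.add_mem _ (hq p v) (Submodule.smul_mem _ _ (hq p _)))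

end NondegSubbundle

/-! ### Metric connections under orthogonal gauge transformations -/

/-- The connection `D` inherits compatibility from its gauge transform `D'`: differentiating the
constant `(g x, g y) = (x, y)` shows that `dg` contributes nothing. -/
theorem GaugeRel.isMetric [IsManifold 𝓘(ℂ) 1 S] {g : S → EndE n} {D D' : Connection S n}
    (h : GaugeRel g D.form D'.form) (hg : Smooth g) (ho : ∀ p, IsOrthogonal (g p))
    (hD' : D'.IsMetric) : D.IsMetric := by
  rw [Connection.isMetric_iff] at hD' ⊢
  intro p v x y
  have e : ∀ x, g p (D.form p v x) = D'.form p v (g p x) + diff g p v x := fun x => by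
    have := congrArg (fun X : EndE n => X x) (h p v)
    simp only [mul_apply_eq_comp, sub_apply] at this
    rw [this]; abel
  have hd := diff_bilinear (metricCLM n) (hg.apply (smooth_const x)) (hg.apply (smooth_const y)) p v
  simp only [metricCLM_apply, ho _ x y, diff_const, diff_apply hg (smooth_const _)] at hd
  simp only [Pi.zero_apply, zero_apply, map_zero, add_zero] at hd
  have hs := hD' p v (g p x) (g p y)
  rw [← ho p, ← ho p x, e, e, map_add, map_add, LinearMap.add_apply]
  linear_combination hs - hd

/-! ### Flatness of families -/

theorem isFlat_of_eventually_isFlat {a : ℂ → ℂ →L[ℝ] EndE n} {ι : Type*} {l : Filter ι} [l.NeBot]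
    {b : ι → ℂ → ℂ →L[ℝ] EndE n} {z : ℂ}
    (h0 : ∀ v, Tendsto (fun i => b i z v) l (𝓝 (a z v)))
    (h1 : ∀ v w, Tendsto (fun i => fderiv ℝ (b i) z v w) l (𝓝 (fderiv ℝ a z v w))) {v w : ℂ}
    (hb : ∀ᶠ i in l, curvature (b i) z v w = 0) : curvature a z v w = 0 := by
  have h : Tendsto (fun i => curvature (b i) z v w) l (𝓝 (curvature a z v w)) :=
    ((h1 v w).sub (h1 w v)).add (((h0 v).mul (h0 w)).sub ((h0 w).mul (h0 v)))
  exact tendsto_nhds_unique h (tendsto_const_nhds.congr' (hb.mono fun _ hi => hi.symm))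

theorem NondegSubbundle.inChart_familyForm (V : NondegSubbundle S n) (A q : OneForm S (EndE n))
    (μ : ℂ) (p₀ : S) : inChart (V.familyForm A q μ) p₀ = fun z =>
      inChart A p₀ z + (μ⁻¹ - 1) • inChart (part10 (V.normalForm A)) p₀ z
        + (μ - 1) • inChart (part01 (V.normalForm A)) p₀ z
        + (μ⁻¹ ^ 2 - 1) • inChart (part10 q) p₀ z + (μ ^ 2 - 1) • inChart (part01 q) p₀ z := rfl

theorem SmoothForm.differentiableAt {F : Type*} [NormedAddCommGroup F] [NormedSpace ℂ F]
    {α : OneForm S F} (hα : SmoothForm α) (p₀ : S) {z : ℂ}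
    (hz : z ∈ (extChartAt 𝓘(ℝ, ℂ) p₀).target) : DifferentiableAt ℝ (inChart α p₀) z :=
  ((hα p₀).differentiableOn (by simp)).differentiableAt ((isOpen_chart_target p₀).mem_nhds hz)

theorem tendsto_quadratic {G : Type*} [NormedAddCommGroup G] [NormedSpace ℂ G] (x₀ x₁ x₂ x₃ x₄ : G)
    {μ₀ : ℂ} (h : μ₀ ≠ 0) : Tendsto (fun μ : ℂ => x₀ + (μ⁻¹ - 1) • x₁ + (μ - 1) • x₂
      + (μ⁻¹ ^ 2 - 1) • x₃ + (μ ^ 2 - 1) • x₄) (𝓝[≠] μ₀)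
      (𝓝 (x₀ + (μ₀⁻¹ - 1) • x₁ + (μ₀ - 1) • x₂ + (μ₀⁻¹ ^ 2 - 1) • x₃ + (μ₀ ^ 2 - 1) • x₄)) := by
  have h1 : Tendsto (fun μ : ℂ => μ) (𝓝 μ₀) (𝓝 μ₀) := tendsto_id
  have h2 := h1.inv₀ h
  have e1 := (h2.sub_const 1).smul_const x₁
  have e2 := (h1.sub_const 1).smul_const x₂
  have e3 := ((h2.pow 2).sub_const 1).smul_const x₃
  have e4 := ((h1.pow 2).sub_const 1).smul_const x₄
  exact ((((e1.const_add x₀).add e2).add e3).add e4).mono_left nhdsWithin_le_nhds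

theorem fderiv_quadratic {G : Type*} [NormedAddCommGroup G] [NormedSpace ℂ G]
    {f₀ f₁ f₂ f₃ f₄ : ℂ → ℂ →L[ℝ] G} {z : ℂ} (h₀ : DifferentiableAt ℝ f₀ z)
    (h₁ : DifferentiableAt ℝ f₁ z) (h₂ : DifferentiableAt ℝ f₂ z) (h₃ : DifferentiableAt ℝ f₃ z)
    (h₄ : DifferentiableAt ℝ f₄ z) (c₁ c₂ c₃ c₄ : ℂ) (v w : ℂ) :
    fderiv ℝ (fun z => f₀ z + c₁ • f₁ z + c₂ • f₂ z + c₃ • f₃ z + c₄ • f₄ z) z v w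
      = fderiv ℝ f₀ z v w + c₁ • fderiv ℝ f₁ z v w + c₂ • fderiv ℝ f₂ z v w
        + c₃ • fderiv ℝ f₃ z v w + c₄ • fderiv ℝ f₄ z v w := by
  have e₁ := h₁.hasFDerivAt.fun_const_smul c₁
  have e₂ := h₂.hasFDerivAt.fun_const_smul c₂
  have e₃ := h₃.hasFDerivAt.fun_const_smul c₃
  have e₄ := h₄.hasFDerivAt.fun_const_smul c₄
  rw [((((h₀.hasFDerivAt.fun_add e₁).fun_add e₂).fun_add e₃).fun_add e₄).fderiv]
  rfl

/-- Holomorphy in `μ` at each fixed point says nothing about derivatives along the surface. The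
explicit Laurent form does: its coefficients are smooth forms independent of `μ`, so the curvature
is continuous in `μ`. -/
theorem NondegSubbundle.isFlat_of_eventually [IsManifold 𝓘(ℂ) 1 S] (V : NondegSubbundle S n)
    {A q : OneForm S (EndE n)} (hA : SmoothForm A) (hq : SmoothForm q) {D : ℂ → Connection S n}
    (hD : ∀ μ ≠ 0, (D μ).form = V.familyForm A q μ) {μ₀ : ℂ} (h₀ : μ₀ ≠ 0)
    (hflat : ∀ᶠ μ in 𝓝[≠] μ₀, (D μ).IsFlat) : (D μ₀).IsFlat := by
  intro p₀ z hz v w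
  have hN := V.normalForm_smooth hA
  have hder := fun (μ : ℂ) v w =>
    fderiv_quadratic (hA.differentiableAt p₀ hz) (hN.part10.differentiableAt p₀ hz)
      (hN.part01.differentiableAt p₀ hz) (hq.part10.differentiableAt p₀ hz)
      (hq.part01.differentiableAt p₀ hz) (μ⁻¹ - 1) (μ - 1) (μ⁻¹ ^ 2 - 1) (μ ^ 2 - 1) v w
  have hval : ∀ μ v, inChart (V.familyForm A q μ) p₀ z v = inChart A p₀ z v
      + (μ⁻¹ - 1) • inChart (part10 (V.normalForm A)) p₀ z v
      + (μ - 1) • inChart (part01 (V.normalForm A)) p₀ z v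
      + (μ⁻¹ ^ 2 - 1) • inChart (part10 q) p₀ z v
      + (μ ^ 2 - 1) • inChart (part01 q) p₀ z v := fun _ _ => rfl
  have hev : ∀ᶠ μ in 𝓝[≠] μ₀, μ ≠ 0 :=
    eventually_nhdsWithin_of_eventually_nhds (isOpen_ne.mem_nhds h₀)
  change curvature (inChart (D μ₀).form p₀) z v w = 0
  rw [hD μ₀ h₀]
  refine isFlat_of_eventually_isFlat (l := 𝓝[≠] μ₀)
    (b := fun μ => inChart (V.familyForm A q μ) p₀) (fun v => ?_) (fun v w => ?_) ?_
  · simp only [hval]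
    exact tendsto_quadratic _ _ _ _ _ h₀
  · simp only [V.inChart_familyForm, hder]
    exact tendsto_quadratic _ _ _ _ _ h₀
  · filter_upwards [hflat, hev] with μ hμ hμ0
    rw [← hD μ hμ0]
    exact hμ p₀ z hz v w

end

/-! ### Types of the spectral family and the identification of the dressed family. -/

section

variable {S : Type*} [TopologicalSpace S] [ChartedSpace ℂ S]
variable {n : ℕ}

section

variable {F : Type*} [NormedAddCommGroup F] [NormedSpace ℂ F]

theorem part10_smul (c : ℂ) (α : OneForm S F) : part10 (c • α) = c • part10 α := by
  funext p; ext v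
  change (1 / 2 : ℂ) • (c • α p v - Complex.I • c • α p (J p v))
    = c • (1 / 2 : ℂ) • (α p v - Complex.I • α p (J p v))
  module

theorem part01_smul (c : ℂ) (α : OneForm S F) : part01 (c • α) = c • part01 α := by
  funext p; ext v
  change (1 / 2 : ℂ) • (c • α p v + Complex.I • c • α p (J p v))
    = c • (1 / 2 : ℂ) • (α p v + Complex.I • α p (J p v))
  module

theorem part10_part10 (α : OneForm S F) : part10 (part10 α) = part10 α :=
  part10_eq_self (part10_J α)

theorem part10_part01 (α : OneForm S F) : part10 (part01 α) = 0 :=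
  part10_eq_zero (part01_J α)

theorem part01_part10 (α : OneForm S F) : part01 (part10 α) = 0 :=
  part01_eq_zero (part10_J α)

theorem part01_part01 (α : OneForm S F) : part01 (part01 α) = part01 α :=
  part01_eq_self (part01_J α)

end

theorem part10_familyForm (V : NondegSubbundle S n) (A q : OneForm S (EndE n)) (μ : ℂ) :
    part10 (V.familyForm A q μ)
      = part10 A + (μ⁻¹ - 1) • part10 (V.normalForm A) + (μ⁻¹ ^ 2 - 1) • part10 q := by
  simp only [NondegSubbundle.familyForm, part10_add, part10_smul, part10_part10, part10_part01,
    smul_zero, add_zero]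

theorem part01_familyForm (V : NondegSubbundle S n) (A q : OneForm S (EndE n)) (μ : ℂ) :
    part01 (V.familyForm A q μ)
      = part01 A + (μ - 1) • part01 (V.normalForm A) + (μ ^ 2 - 1) • part01 q := by
  simp only [NondegSubbundle.familyForm, part01_add, part01_smul, part01_part01, part01_part10,
    smul_zero, add_zero]

theorem GaugeRel.part10 {g : S → EndE n} {A A' : OneForm S (EndE n)} (h : GaugeRel g A A') (p : S)
    (v : TangentSpace 𝓘(ℝ, ℂ) p) :
    part10 A' p v * g p = g p * part10 A p v - part10 (diff g) p v := by
  simp only [part10_apply, smul_mul_assoc, sub_mul, mul_smul_comm, mul_sub, h p]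
  module

theorem GaugeRel.part01 {g : S → EndE n} {A A' : OneForm S (EndE n)} (h : GaugeRel g A A') (p : S)
    (v : TangentSpace 𝓘(ℝ, ℂ) p) :
    part01 A' p v * g p = g p * part01 A p v - part01 (diff g) p v := by
  simp only [part01_apply, smul_mul_assoc, add_mul, mul_smul_comm, mul_add, h p]
  module

theorem tendsto_part10 {ι : Type*} {l : Filter ι} {α : ι → OneForm S (EndE n)}
    {β : OneForm S (EndE n)} {p : S}
    (h : ∀ v : TangentSpace 𝓘(ℝ, ℂ) p, Tendsto (fun i => α i p v) l (𝓝 (β p v)))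
    (v : TangentSpace 𝓘(ℝ, ℂ) p) : Tendsto (fun i => part10 (α i) p v) l (𝓝 (part10 β p v)) :=
  ((h v).sub ((h (J p v)).const_smul Complex.I)).const_smul (1 / 2 : ℂ)

theorem tendsto_part01 {ι : Type*} {l : Filter ι} {α : ι → OneForm S (EndE n)}
    {β : OneForm S (EndE n)} {p : S}
    (h : ∀ v : TangentSpace 𝓘(ℝ, ℂ) p, Tendsto (fun i => α i p v) l (𝓝 (β p v)))
    (v : TangentSpace 𝓘(ℝ, ℂ) p) : Tendsto (fun i => part01 (α i) p v) l (𝓝 (part01 β p v)) :=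
  ((h v).add ((h (J p v)).const_smul Complex.I)).const_smul (1 / 2 : ℂ)

/-! ### The Laurent expansion of the dressed family -/

section Dressing

variable [IsManifold 𝓘(ℂ) 1 S] {V : NondegSubbundle S n} {q : OneForm S (EndE n)}
  {r : RationalFamily S n} {r_inf : S → EndE n} {Ahat : ℂ → OneForm S (EndE n)}

/-- The Liouville argument is applied to `μ² X(μ)`, with `X` the (1,0)-part: it extends over `0` and
is `O(μ²)` at infinity. Dividing by `μ²` gives a polynomial of degree at most two in `μ⁻¹`. -/
theorem dressed_part10 (h_zero : (0 : ℂ) ∈ r.dom) (h_inf : r.HolomorphicAtInfinity r_inf)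
    (h_orth : ∀ μ ∈ r.dom, ∀ p : S, IsOrthogonal (r.val μ p))
    (h_orth_inf : ∀ p, IsOrthogonal (r_inf p))
    (h_holo : ∀ (p : S) (v : TangentSpace 𝓘(ℝ, ℂ) p),
      DifferentiableOn ℂ (fun μ : ℂ => Ahat μ p v) {0}ᶜ)
    (hg : ∀ μ ∈ r.dom, μ ≠ 0 → GaugeRel (r.val μ) (V.familyForm 0 q μ) (Ahat μ))
    {μ : ℂ} (hμ : μ ≠ 0) (p : S) (v : TangentSpace 𝓘(ℝ, ℂ) p) :
    part10 (Ahat μ) p v = part10 (Ahat 1) p v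
      + (μ⁻¹ - 1) • (1 / 2 : ℂ) • (part10 (Ahat 1) p v - part10 (Ahat (-1)) p v)
      + (μ⁻¹ ^ 2 - 1) • adForm (r.val 0) (part10 q) p v := by
  set X : ℂ → EndE n := fun μ => part10 (Ahat μ) p v with hX
  have hXd : DifferentiableOn ℂ X {0}ᶜ :=
    ((h_holo p v).sub ((h_holo p (J p v)).const_smul Complex.I)).const_smul (1 / 2 : ℂ)
  have hrel : ∀ μ ∈ r.dom, μ ≠ 0 → X μ * r.val μ p = r.val μ p *
      ((μ⁻¹ - 1) • part10 (V.normalForm 0) p v + (μ⁻¹ ^ 2 - 1) • part10 q p v)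
        - (1 : ℂ) • part10 (diff (r.val μ)) p v := fun μ hμ hμ0 => by
    rw [one_smul, hX]
    refine ((hg μ hμ hμ0).part10 p v).trans ?_
    rw [part10_familyForm]
    have h0 : part10 (0 : OneForm S (EndE n)) p v = 0 := by simp [part10_apply]
    change r.val μ p * (part10 0 p v + (μ⁻¹ - 1) • part10 (V.normalForm 0) p v
      + (μ⁻¹ ^ 2 - 1) • part10 q p v) - _ = _
    rw [h0, zero_add]
  have hdom0 := r.eventually_mem_dom 0
  have hne0 : ∀ᶠ μ : ℂ in 𝓝[≠] 0, μ ≠ 0 := self_mem_nhdsWithin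
  have hdom := r.eventually_mem_dom_cocompact
  -- The factor `μ²` turns the coefficients of the normal form, of `q` and of `dr` into `μ - μ²`, `1
  -- - μ²` and `μ²`; at `0` only `q` survives.
  have h0 : Tendsto (fun μ => μ ^ 2 • X μ) (𝓝[≠] 0) (𝓝 (adForm (r.val 0) (part10 q) p v)) := by
    have h := tendsto_of_gauge_eq (l := 𝓝[≠] 0) (X := fun μ => μ ^ 2 • X μ)
      (a := fun μ => μ - μ ^ 2) (b := fun μ => 1 - μ ^ 2) (e := fun μ => μ ^ 2)
      (N := part10 (V.normalForm 0) p v) (q := part10 q p v)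
      ((RationalFamily.tendsto_val h_zero p).mono_left nhdsWithin_le_nhds)
      (hdom0.mono fun μ hμ => (h_orth μ hμ p).isUnit) (h_orth 0 h_zero p).isUnit
      (tendsto_part10 (fun v => (RationalFamily.tendsto_diff_val h_zero p v).mono_left
        nhdsWithin_le_nhds) v)
      (Continuous.tendsto' (by fun_prop) 0 0 (by simp) |>.mono_left nhdsWithin_le_nhds)
      (Continuous.tendsto' (by fun_prop) 0 1 (by simp) |>.mono_left nhdsWithin_le_nhds)
      (Continuous.tendsto' (by fun_prop) 0 0 (by simp) |>.mono_left nhdsWithin_le_nhds)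
      (by
        filter_upwards [hdom0, hne0] with μ hμ hμ0
        rw [smul_mul_assoc, hrel μ hμ hμ0, smul_sub, ← mul_smul_comm, smul_add]
        simp only [smul_smul]
        rw [show μ ^ 2 * (μ⁻¹ - 1) = μ - μ ^ 2 by field_simp,
          show μ ^ 2 * (μ⁻¹ ^ 2 - 1) = 1 - μ ^ 2 by field_simp, mul_one])
    simpa [adForm_apply] using h
  have hinf : ∃ L, Tendsto X (cocompact ℂ) (𝓝 L) := by
    have hinv := tendsto_inv_cocompact
    exact ⟨_, tendsto_of_gauge_eq (h_inf p) (hdom.mono fun μ hμ => (h_orth μ hμ p).isUnit)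
      (h_orth_inf p).isUnit (tendsto_part10 (fun v => h_inf.tendsto_diff p v) v)
      (hinv.sub_const 1) ((hinv.pow 2).sub_const 1) tendsto_const_nhds
      ((hdom.and eventually_ne_zero_cocompact).mono fun μ hμ => hrel μ hμ.1 hμ.2)⟩
  obtain ⟨L, hL⟩ := hinf
  have hf : DifferentiableOn ℂ (fun μ => μ ^ 2 • X μ) {0}ᶜ := (differentiableOn_pow 2).smul hXd
  have hL' : Tendsto (fun μ : ℂ => μ⁻¹ ^ 2 • μ ^ 2 • X μ) (cocompact ℂ) (𝓝 L) := by
    refine hL.congr' ?_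
    filter_upwards [eventually_ne_zero_cocompact] with μ hμ
    rw [smul_smul, ← mul_pow, inv_mul_cancel₀ hμ, one_pow, one_smul]
  have key := fun {μ : ℂ} (hμ : μ ≠ 0) => eq_quadratic_of_tendsto hf h0 hL' hμ
  have k1 := key one_ne_zero
  simp only [one_pow, one_smul, neg_sq] at k1
  have kμ := key hμ
  simp only [one_pow, one_smul, neg_sq] at kμ
  -- The limit at infinity need not be computed: evaluation at `μ = 1` determines it.
  have hLe : L = X 1 - adForm (r.val 0) (part10 q) p v - (1 / 2 : ℂ) • (X 1 - X (-1)) := by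
    rw [eq_sub_iff_add_eq, eq_sub_iff_add_eq]
    refine Eq.trans ?_ k1.symm
    abel
  change X μ = X 1 + (μ⁻¹ - 1) • (1 / 2 : ℂ) • (X 1 - X (-1)) + _
  have : X μ = μ⁻¹ ^ 2 • μ ^ 2 • X μ := by
    rw [smul_smul, ← mul_pow, inv_mul_cancel₀ hμ, one_pow, one_smul]
  rw [this, kμ, hLe]
  simp only [smul_add, smul_sub, smul_smul]
  rw [show μ⁻¹ ^ 2 * (μ * (1 / 2)) = μ⁻¹ * (1 / 2) by field_simp,
    show μ⁻¹ ^ 2 * (μ ^ 2) = 1 by field_simp,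
    show μ⁻¹ ^ 2 * (μ ^ 2 * (1 / 2)) = 1 / 2 by field_simp]
  module

/-- Here `X` itself, the (0,1)-part, extends over `0`, and `μ⁻² X(μ)` converges at infinity, where
only `q` survives. -/
theorem dressed_part01 (h_zero : (0 : ℂ) ∈ r.dom) (h_inf : r.HolomorphicAtInfinity r_inf)
    (h_orth : ∀ μ ∈ r.dom, ∀ p : S, IsOrthogonal (r.val μ p))
    (h_orth_inf : ∀ p, IsOrthogonal (r_inf p))
    (h_holo : ∀ (p : S) (v : TangentSpace 𝓘(ℝ, ℂ) p),
      DifferentiableOn ℂ (fun μ : ℂ => Ahat μ p v) {0}ᶜ)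
    (hg : ∀ μ ∈ r.dom, μ ≠ 0 → GaugeRel (r.val μ) (V.familyForm 0 q μ) (Ahat μ))
    {μ : ℂ} (hμ : μ ≠ 0) (p : S) (v : TangentSpace 𝓘(ℝ, ℂ) p) :
    part01 (Ahat μ) p v = part01 (Ahat 1) p v
      + (μ - 1) • (1 / 2 : ℂ) • (part01 (Ahat 1) p v - part01 (Ahat (-1)) p v)
      + (μ ^ 2 - 1) • adForm r_inf (part01 q) p v := by
  set X : ℂ → EndE n := fun μ => part01 (Ahat μ) p v with hX
  have hXd : DifferentiableOn ℂ X {0}ᶜ :=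
    ((h_holo p v).add ((h_holo p (J p v)).const_smul Complex.I)).const_smul (1 / 2 : ℂ)
  have hrel : ∀ μ ∈ r.dom, μ ≠ 0 → X μ * r.val μ p = r.val μ p *
      ((μ - 1) • part01 (V.normalForm 0) p v + (μ ^ 2 - 1) • part01 q p v)
        - (1 : ℂ) • part01 (diff (r.val μ)) p v := fun μ hμ hμ0 => by
    rw [one_smul, hX]
    refine ((hg μ hμ hμ0).part01 p v).trans ?_
    rw [part01_familyForm]
    have h0 : part01 (0 : OneForm S (EndE n)) p v = 0 := by simp [part01_apply]
    change r.val μ p * (part01 0 p v + (μ - 1) • part01 (V.normalForm 0) p v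
      + (μ ^ 2 - 1) • part01 q p v) - _ = _
    rw [h0, zero_add]
  have hdom0 := r.eventually_mem_dom 0
  have hne0 : ∀ᶠ μ : ℂ in 𝓝[≠] 0, μ ≠ 0 := self_mem_nhdsWithin
  have hdom := r.eventually_mem_dom_cocompact
  have hc : ∃ c, Tendsto X (𝓝[≠] 0) (𝓝 c) :=
    ⟨_, tendsto_of_gauge_eq ((RationalFamily.tendsto_val h_zero p).mono_left nhdsWithin_le_nhds)
      (hdom0.mono fun μ hμ => (h_orth μ hμ p).isUnit) (h_orth 0 h_zero p).isUnit
      (tendsto_part01 (fun v => (RationalFamily.tendsto_diff_val h_zero p v).mono_left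
        nhdsWithin_le_nhds) v)
      (Continuous.tendsto (by fun_prop : Continuous fun μ : ℂ => μ - 1) 0 |>.mono_left
        nhdsWithin_le_nhds)
      (Continuous.tendsto (by fun_prop : Continuous fun μ : ℂ => μ ^ 2 - 1) 0 |>.mono_left
        nhdsWithin_le_nhds)
      tendsto_const_nhds
      ((hdom0.and hne0).mono fun μ hμ => hrel μ hμ.1 hμ.2)⟩
  have hinf : Tendsto (fun μ : ℂ => μ⁻¹ ^ 2 • X μ) (cocompact ℂ)
      (𝓝 (adForm r_inf (part01 q) p v)) := by
    have hinv := tendsto_inv_cocompact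
    have hinv2 : Tendsto (fun μ : ℂ => μ⁻¹ ^ 2) (cocompact ℂ) (𝓝 0) := by
      simpa using hinv.pow 2
    have h := tendsto_of_gauge_eq (l := cocompact ℂ) (X := fun μ => μ⁻¹ ^ 2 • X μ)
      (a := fun μ => μ⁻¹ - μ⁻¹ ^ 2) (b := fun μ => 1 - μ⁻¹ ^ 2) (e := fun μ => μ⁻¹ ^ 2)
      (N := part01 (V.normalForm 0) p v) (q := part01 q p v)
      (h_inf p) (hdom.mono fun μ hμ => (h_orth μ hμ p).isUnit) (h_orth_inf p).isUnit
      (tendsto_part01 (fun v => h_inf.tendsto_diff p v) v)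
      (hinv.sub hinv2) (hinv2.const_sub 1) hinv2
      (by
        filter_upwards [hdom, eventually_ne_zero_cocompact] with μ hμ hμ0
        rw [smul_mul_assoc, hrel μ hμ hμ0, smul_sub, ← mul_smul_comm, smul_add]
        simp only [smul_smul]
        rw [show μ⁻¹ ^ 2 * (μ - 1) = μ⁻¹ - μ⁻¹ ^ 2 by field_simp,
          show μ⁻¹ ^ 2 * (μ ^ 2 - 1) = 1 - μ⁻¹ ^ 2 by field_simp, mul_one])
    simpa [adForm_apply] using h
  obtain ⟨c, hc⟩ := hc
  have key := fun {μ : ℂ} (hμ : μ ≠ 0) => eq_quadratic_of_tendsto hXd hc hinf hμ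
  have k1 := key one_ne_zero
  simp only [one_pow, one_smul] at k1
  have hce : c = X 1 - adForm r_inf (part01 q) p v - (1 / 2 : ℂ) • (X 1 - X (-1)) := by
    rw [eq_sub_iff_add_eq, eq_sub_iff_add_eq]
    exact k1.symm
  change X μ = X 1 + (μ - 1) • (1 / 2 : ℂ) • (X 1 - X (-1)) + _
  rw [key hμ, hce]
  module

/-- Since `r(-μ) ρ = ρ r(μ)`, gauging the original family by `r(μ)` and then `ρ` agrees with gauging
by `ρ` and then `r(-μ)`. -/
theorem twist_of_mem (h_twist : ∀ μ ∈ r.dom, -μ ∈ r.dom → ∀ p : S,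
      V.refl p * r.val μ p * V.refl p = r.val (-μ) p)
    (h_orth : ∀ μ ∈ r.dom, ∀ p : S, IsOrthogonal (r.val μ p))
    (hq : ∀ (p : S) (v : TangentSpace 𝓘(ℝ, ℂ) p), q p v * V.refl p = V.refl p * q p v)
    (hg : ∀ μ ∈ r.dom, μ ≠ 0 → GaugeRel (r.val μ) (V.familyForm 0 q μ) (Ahat μ))
    {μ : ℂ} (hμ0 : μ ≠ 0) (hμ : μ ∈ r.dom) (hμ' : -μ ∈ r.dom) (p : S)
    (v : TangentSpace 𝓘(ℝ, ℂ) p) :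
    Ahat (-μ) p v * V.refl p = V.refl p * Ahat μ p v - diff V.refl p v := by
  have hc : ∀ p, r.val (-μ) p * V.refl p = V.refl p * r.val μ p := fun p => by
    rw [← h_twist μ hμ hμ' p, mul_assoc _ (V.refl p) (V.refl p), V.refl_mul_refl, mul_one]
  have d1 := diff_mul (r.smooth_val (-μ)) V.smooth_refl p v
  have d2 := diff_mul V.smooth_refl (r.smooth_val μ) p v
  simp only [hc] at d1
  rw [d1] at d2
  have g1 := hg μ hμ hμ0 p v
  have g2 := hg (-μ) hμ' (neg_ne_zero.2 hμ0) p v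
  have ht := V.familyForm_neg_mul_refl (A := 0) hq μ p v
  refine (h_orth μ hμ p).isUnit.mul_right_cancel ?_
  rw [mul_assoc, ← hc, ← mul_assoc, g2, sub_mul, mul_assoc, ht, mul_sub, ← mul_assoc, hc,
    sub_mul, mul_assoc (V.refl p) (Ahat μ p v), g1, mul_sub, mul_assoc, eq_sub_of_add_eq d2]
  abel

/-- The relation says that `Â(-1)` is `Â(1)` gauged by `ρ`; half the difference is then the normal
form by its very formula. -/
theorem twist_one (h_twist : ∀ μ ∈ r.dom, -μ ∈ r.dom → ∀ p : S,
      V.refl p * r.val μ p * V.refl p = r.val (-μ) p)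
    (h_orth : ∀ μ ∈ r.dom, ∀ p : S, IsOrthogonal (r.val μ p))
    (h_holo : ∀ (p : S) (v : TangentSpace 𝓘(ℝ, ℂ) p),
      DifferentiableOn ℂ (fun μ : ℂ => Ahat μ p v) {0}ᶜ)
    (hq : ∀ (p : S) (v : TangentSpace 𝓘(ℝ, ℂ) p), q p v * V.refl p = V.refl p * q p v)
    (hg : ∀ μ ∈ r.dom, μ ≠ 0 → GaugeRel (r.val μ) (V.familyForm 0 q μ) (Ahat μ))
    (p : S) (v : TangentSpace 𝓘(ℝ, ℂ) p) :
    (1 / 2 : ℂ) • (Ahat 1 p v - Ahat (-1) p v) = V.normalForm (Ahat 1) p v := by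
  have hcont : ∀ μ₀ : ℂ, μ₀ ≠ 0 → Tendsto (fun μ => Ahat μ p v) (𝓝 μ₀) (𝓝 (Ahat μ₀ p v)) :=
    fun μ₀ h => ((h_holo p v).differentiableAt (isOpen_ne.mem_nhds h)).continuousAt
  have hneg : Tendsto (fun μ : ℂ => -μ) (𝓝[≠] 1) (𝓝[≠] (-1)) :=
    tendsto_nhdsWithin_of_tendsto_nhds_of_eventually_within _
      ((continuous_neg.tendsto (1 : ℂ)).mono_left nhdsWithin_le_nhds)
      (eventually_mem_nhdsWithin.mono fun μ hμ h => hμ (neg_injective h))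
  have h1 : Tendsto (fun μ => Ahat (-μ) p v * V.refl p) (𝓝[≠] 1)
      (𝓝 (Ahat (-1) p v * V.refl p)) :=
    ((hcont (-1) (neg_ne_zero.2 one_ne_zero)).comp (hneg.mono_right nhdsWithin_le_nhds)).mul_const _
  have h2 : Tendsto (fun μ => V.refl p * Ahat μ p v - diff V.refl p v) (𝓝[≠] 1)
      (𝓝 (V.refl p * Ahat 1 p v - diff V.refl p v)) :=
    (((hcont 1 one_ne_zero).mono_left nhdsWithin_le_nhds).const_mul _).sub_const _
  have hev : ∀ᶠ μ : ℂ in 𝓝[≠] 1, μ ≠ 0 :=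
    eventually_nhdsWithin_of_eventually_nhds (isOpen_ne.mem_nhds one_ne_zero)
  -- Either of `±1` may be a pole of `r`, so the twist relation is obtained as a limit `μ → 1`.
  have h : Ahat (-1) p v * V.refl p = V.refl p * Ahat 1 p v - diff V.refl p v := by
    refine tendsto_nhds_unique h1 (h2.congr' ?_)
    filter_upwards [hev, r.eventually_mem_dom 1, hneg.eventually (r.eventually_mem_dom (-1))]
      with μ hμ0 hμ hμ'
    exact (twist_of_mem h_twist h_orth hq hg hμ0 hμ hμ' p v).symm
  have h' : Ahat (-1) p v = V.refl p * Ahat 1 p v * V.refl p + V.refl p * diff V.refl p v := by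
    rw [← mul_one (Ahat (-1) p v), ← V.refl_mul_refl p, ← mul_assoc, h, sub_mul, V.diff_refl_mul]
    abel
  rw [h', NondegSubbundle.normalForm_apply, sub_add_eq_sub_sub]

theorem dressed_form_eq (h_zero : (0 : ℂ) ∈ r.dom) (h_inf : r.HolomorphicAtInfinity r_inf)
    (h_orth : ∀ μ ∈ r.dom, ∀ p : S, IsOrthogonal (r.val μ p))
    (h_orth_inf : ∀ p, IsOrthogonal (r_inf p))
    (h_twist : ∀ μ ∈ r.dom, -μ ∈ r.dom → ∀ p : S,
      V.refl p * r.val μ p * V.refl p = r.val (-μ) p)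
    (h_holo : ∀ (p : S) (v : TangentSpace 𝓘(ℝ, ℂ) p),
      DifferentiableOn ℂ (fun μ : ℂ => Ahat μ p v) {0}ᶜ)
    (hq : ∀ (p : S) (v : TangentSpace 𝓘(ℝ, ℂ) p), q p v * V.refl p = V.refl p * q p v)
    (hg : ∀ μ ∈ r.dom, μ ≠ 0 → GaugeRel (r.val μ) (V.familyForm 0 q μ) (Ahat μ))
    {μ : ℂ} (hμ : μ ≠ 0) :
    Ahat μ = V.familyForm (Ahat 1) (dressedForm (r.val 0) r_inf q) μ := by
  funext p; ext v : 1
  have hodd := fun v => twist_one h_twist h_orth h_holo hq hg p v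
  have h10 : (1 / 2 : ℂ) • (part10 (Ahat 1) p v - part10 (Ahat (-1)) p v)
      = part10 (V.normalForm (Ahat 1)) p v := by
    simp only [part10_apply, ← hodd]; module
  have h01 : (1 / 2 : ℂ) • (part01 (Ahat 1) p v - part01 (Ahat (-1)) p v)
      = part01 (V.normalForm (Ahat 1)) p v := by
    simp only [part01_apply, ← hodd]; module
  have e10 := dressed_part10 h_zero h_inf h_orth h_orth_inf h_holo hg hμ p v
  have e01 := dressed_part01 h_zero h_inf h_orth h_orth_inf h_holo hg hμ p v
  have hsum : ∀ α : OneForm S (EndE n), α p v = part10 α p v + part01 α p v := fun α =>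
    (congrArg (fun β : OneForm S (EndE n) => β p v) (part10_add_part01 α)).symm
  rw [NondegSubbundle.familyForm_apply, part10_dressedForm, part01_dressedForm, hsum (Ahat μ),
    hsum (Ahat 1), e10, e01, h10, h01]
  abel

end Dressing

end

/-! ### Passage to limits, flatness, and the return to the trivial connection. -/

theorem tendsto_clm_of_apply {F : Type*} [NormedAddCommGroup F] [NormedSpace ℂ F] {ι : Type*}
    {l : Filter ι} {T : ι → ℂ →L[ℝ] F} {T₀ : ℂ →L[ℝ] F}
    (h : ∀ v, Tendsto (fun i => T i v) l (𝓝 (T₀ v))) : Tendsto T l (𝓝 T₀) := by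
  -- A real-linear map on `ℂ` is a continuous function of its values on the basis `1, i`.
  have e : ∀ A : ℂ →L[ℝ] F, A = ContinuousLinearMap.smulRightL ℝ ℂ F Complex.reCLM (A 1)
      + ContinuousLinearMap.smulRightL ℝ ℂ F Complex.imCLM (A Complex.I) := fun A => by
    ext v
    conv_lhs => rw [← Complex.re_add_im v, ← mul_one (v.re : ℂ), ← Complex.real_smul,
      ← Complex.real_smul, map_add, map_smul, map_smul]
    rfl
  rw [e T₀]
  refine Tendsto.congr (fun i => (e (T i)).symm) ?_
  exact ((ContinuousLinearMap.continuous _).tendsto _ |>.comp (h 1)).add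
    ((ContinuousLinearMap.continuous _).tendsto _ |>.comp (h Complex.I))

theorem Connection.tendsto_op {S : Type*} [TopologicalSpace S] [ChartedSpace ℂ S] {n : ℕ}
    {D : ℂ → Connection S n} {μ₀ : ℂ} {s : S → E n} {p : S}
    (h : ∀ v : TangentSpace 𝓘(ℝ, ℂ) p,
      Tendsto (fun μ => (D μ).form p v) (𝓝[≠] μ₀) (𝓝 ((D μ₀).form p v))) :
    Tendsto (fun μ => (D μ).op s p) (𝓝[≠] μ₀) (𝓝 ((D μ₀).op s p)) := by
  refine tendsto_clm_of_apply fun v => ?_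
  exact (((ContinuousLinearMap.apply ℂ (E n) (s p)).continuous.tendsto _).comp (h v)).const_add _


section

variable {S : Type*} [TopologicalSpace S] [ChartedSpace ℂ S] {n : ℕ} {V : NondegSubbundle S n}
  {r : RationalFamily S n} {r_inf : S → EndE n}

theorem RationalFamily.HolomorphicAtInfinity.isOrthogonal (h_inf : r.HolomorphicAtInfinity r_inf)
    (h_orth : ∀ μ ∈ r.dom, ∀ p : S, IsOrthogonal (r.val μ p)) (p : S) : IsOrthogonal (r_inf p) :=
  isOrthogonal_of_tendsto (r.eventually_mem_dom_cocompact.mono fun μ hμ => h_orth μ hμ p) (h_inf p)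

/-- Infinity is fixed by `μ ↦ -μ`, so the twisting condition becomes commutation with `ρ` in the
limit. -/
theorem RationalFamily.HolomorphicAtInfinity.refl_conj (h_inf : r.HolomorphicAtInfinity r_inf)
    (h_twist : ∀ μ ∈ r.dom, -μ ∈ r.dom → ∀ p : S,
      V.refl p * r.val μ p * V.refl p = r.val (-μ) p) (p : S) :
    V.refl p * r_inf p * V.refl p = r_inf p := by
  have hneg : Tendsto (fun μ : ℂ => -μ) (cocompact ℂ) (cocompact ℂ) :=
    (Homeomorph.neg ℂ).isClosedEmbedding.tendsto_cocompact
  refine tendsto_nhds_unique (((h_inf p).const_mul _).mul_const _) (((h_inf p).comp hneg).congr' ?_)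
  filter_upwards [r.eventually_mem_dom_cocompact,
    hneg.eventually r.eventually_mem_dom_cocompact] with μ hμ hμ'
  exact (h_twist μ hμ hμ' p).symm

variable [IsManifold 𝓘(ℂ) 1 S] {q : OneForm S (EndE n)}

/-- Gauging a constrained harmonic bundle back to the trivial connection. -/
theorem NondegSubbundle.IsConstrainedHarmonic.map_inverse {D : Connection S n}
    (h : V.IsConstrainedHarmonic D q) {g : S → EndE n} (hs : Smooth g)
    (ho : ∀ p, IsOrthogonal (g p)) (hg : GaugeRel g (trivialConnection S n).form D.form)
    (hsi : Smooth fun p => Ring.inverse (g p)) (hi : ∀ p, IsOrthogonal (Ring.inverse (g p))) :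
    (V.map (fun p => Ring.inverse (g p)) hsi hi).IsConstrainedHarmonic (trivialConnection S n)
      (adForm (fun p => Ring.inverse (g p)) q) := by
  obtain ⟨hq_smooth, hq_mem, hq⟩ := h
  have hq'_smooth : SmoothForm (adForm (fun p => Ring.inverse (g p)) q) :=
    hq_smooth.adForm hsi fun p => (hi p).isUnit
  refine ⟨hq'_smooth, fun p v => V.adForm_mem q hsi hi (hq_mem p v), fun μ hμ => ?_⟩
  obtain ⟨D₁, hD₁, hD₁m, hD₁f⟩ := hq μ hμ
  rw [V.represents_family_iff] at hD₁
  have hrefl : ∀ p, g p * (V.map (fun p => Ring.inverse (g p)) hsi hi).refl p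
      = V.refl p * g p := fun p => by
    refine (hi p).isUnit.mul_right_cancel ?_
    rw [mul_assoc, V.map_refl _ hsi hi p, ← mul_assoc, (ho p).mul_inverse, one_mul, mul_assoc,
      (ho p).mul_inverse, mul_one]
  have hqq : ∀ (p : S) (v : TangentSpace 𝓘(ℝ, ℂ) p),
      q p v * g p = g p * adForm (fun p => Ring.inverse (g p)) q p v := fun p v => by
    have hii : Ring.inverse (Ring.inverse (g p)) = g p := by
      refine (hi p).isUnit.mul_left_cancel ?_
      rw [(hi p).mul_inverse, (ho p).inverse_mul]
    rw [adForm_apply, hii, ← mul_assoc, ← mul_assoc, (ho p).mul_inverse, one_mul]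
  have hrel := V.gaugeRel_familyForm hs hrefl hg hqq μ
  rw [← hD₁] at hrel
  let D' : Connection S n := ⟨_, NondegSubbundle.familyForm_smooth
    (V.map (fun p => Ring.inverse (g p)) hsi hi) (trivialConnection S n).smooth hq'_smooth μ⟩
  have hrel' : GaugeRel g D'.form D₁.form := hrel
  exact ⟨D', (NondegSubbundle.represents_family_iff _ _ _ _ _).2 rfl, hrel'.isMetric hs ho hD₁m,
    (hrel'.isFlat_iff hs fun p => (ho p).isUnit).2 hD₁f⟩

/-- Off the poles of `r` this is gauge invariance; every `μ₀`, pole or not, is a limit of such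
parameters. -/
theorem dressed_isFlat
    (hq_flat : ∀ μ : ℂ, μ ≠ 0 → ∃ D' : Connection S n,
      D'.Represents (V.family (trivialConnection S n) q μ) ∧ D'.IsMetric ∧ D'.IsFlat)
    (hunit : ∀ μ ∈ r.dom, ∀ p, IsUnit (r.val μ p)) {dhat : ℂ → Connection S n}
    {qhat : OneForm S (EndE n)} (hqhat : SmoothForm qhat)
    (hg : ∀ μ ∈ r.dom, μ ≠ 0 →
      GaugeRel (r.val μ) (V.familyForm (trivialConnection S n).form q μ) (dhat μ).form)
    (hform : ∀ μ : ℂ, μ ≠ 0 → (dhat μ).form = V.familyForm (dhat 1).form qhat μ) {μ₀ : ℂ}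
    (h₀ : μ₀ ≠ 0) : (dhat μ₀).IsFlat := by
  refine V.isFlat_of_eventually (dhat 1).smooth hqhat hform h₀ ?_
  filter_upwards [r.eventually_mem_dom μ₀,
    eventually_nhdsWithin_of_eventually_nhds (isOpen_ne.mem_nhds h₀)] with μ hμ hμ0
  obtain ⟨D', hD', -, hD'_flat⟩ := hq_flat μ hμ0
  have hrel := hg μ hμ hμ0
  rw [← (V.represents_family_iff (trivialConnection S n) D' q μ).1 hD'] at hrel
  exact (hrel.isFlat_iff (r.smooth_val μ) (hunit μ hμ)).1 hD'_flat

end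

end DressingTheory

end

open DressingTheory in
theorem mainTheorem2 (n : ℕ) (S : Type*) [TopologicalSpace S] [ChartedSpace ℂ S]
    [IsManifold 𝓘(ℂ) 1 S]
    (V : NondegSubbundle S n) (q : OneForm S (EndE n))
    (hV : V.IsConstrainedHarmonic (trivialConnection S n) q)
    (r : RationalFamily S n) (r_inf : S → EndE n)
    (h_zero : (0 : ℂ) ∈ r.dom)
    (h_inf : r.HolomorphicAtInfinity r_inf)
    (h_orth : ∀ μ ∈ r.dom, ∀ p : S, IsOrthogonal (r.val μ p))
    (h_twist : ∀ μ ∈ r.dom, -μ ∈ r.dom → ∀ p : S,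
      V.refl p * r.val μ p * V.refl p = r.val (-μ) p)
    (dhat : ℂ → Connection S n)
    (h_metric : ∀ μ : ℂ, μ ≠ 0 → (dhat μ).IsMetric)
    (h_holo : ∀ (p : S) (v : TangentSpace 𝓘(ℝ, ℂ) p),
      DifferentiableOn ℂ (fun μ : ℂ => (dhat μ).form p v) {0}ᶜ)
    (h_ext : ∀ μ ∈ r.dom, μ ≠ 0 →
      (dhat μ).Represents (gauge (r.val μ) (V.family (trivialConnection S n) q μ)))
    (qhat : OneForm S (EndE n)) (h_qhat : qhat = dressedForm (r.val 0) r_inf q) :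
    (part10 qhat = adForm (r.val 0) (part10 q) ∧ part01 qhat = adForm r_inf (part01 q)) ∧
    ((dhat 1).IsFlat ∧ (dhat 1).IsMetric ∧
      ∀ s : S → E n, Smooth s → ∀ p : S,
        Tendsto (fun μ : ℂ => gauge (r.val μ) (V.family (trivialConnection S n) q μ) s p)
          (𝓝[≠] 1) (𝓝 ((dhat 1).op s p))) ∧
    (∀ μ : ℂ, μ ≠ 0 → (dhat μ).Represents (V.family (dhat 1) qhat μ)) ∧
    V.IsConstrainedHarmonic (dhat 1) qhat ∧
    ((1 : ℂ) ∈ r.dom →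
      ∃ W : NondegSubbundle S n,
        (∀ p : S, W.fiber p =
          (V.fiber p).map (Ring.inverse (r.val 1 p) : EndE n).toLinearMap) ∧
        W.IsConstrainedHarmonic (trivialConnection S n)
          (adForm (fun p => Ring.inverse (r.val 1 p)) qhat)) := by
  subst h_qhat
  set qhat := dressedForm (r.val 0) r_inf q with h_qhat
  obtain ⟨hq_smooth, hq_mem, hq_flat⟩ := hV
  have h_orth_inf := h_inf.isOrthogonal h_orth
  have hunit : ∀ μ ∈ r.dom, ∀ p, IsUnit (r.val μ p) := fun μ hμ p => (h_orth μ hμ p).isUnit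
  have c_zero : ∀ p, V.refl p * r.val 0 p * V.refl p = r.val 0 p := fun p => by
    have := h_twist 0 h_zero (by simpa using h_zero) p
    rwa [neg_zero] at this
  have hg : ∀ μ ∈ r.dom, μ ≠ 0 →
      GaugeRel (r.val μ) (V.familyForm (trivialConnection S n).form q μ) (dhat μ).form :=
    fun μ hμ hμ0 => V.gaugeRel_of_represents (r.smooth_val μ) (hunit μ hμ) (h_ext μ hμ hμ0)
  have hform : ∀ μ : ℂ, μ ≠ 0 → (dhat μ).form = V.familyForm (dhat 1).form qhat μ :=
    fun μ hμ => dressed_form_eq (Ahat := fun μ => (dhat μ).form) h_zero h_inf h_orth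
      h_orth_inf h_twist h_holo (fun p v => V.refl_commutes (hq_mem p v)) hg hμ
  have hrep : ∀ μ : ℂ, μ ≠ 0 → (dhat μ).Represents (V.family (dhat 1) qhat μ) :=
    fun μ hμ => (V.represents_family_iff _ _ _ _).2 (hform μ hμ)
  have hqhat_smooth : SmoothForm qhat :=
    (hq_smooth.part10.adForm (r.smooth_val 0) (hunit 0 h_zero)).add
      (hq_smooth.part01.adForm h_inf.smooth fun p => (h_orth_inf p).isUnit)
  have hqhat_mem : ∀ (p : S) (v : TangentSpace 𝓘(ℝ, ℂ) p),
      qhat p v ∈ wedgeSq (V.fiber p) ⊔ wedgeSq (V.perp p) :=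
    V.dressedForm_mem (h_orth 0 h_zero) h_orth_inf c_zero (h_inf.refl_conj h_twist) hq_mem
  have hflat : ∀ μ : ℂ, μ ≠ 0 → (dhat μ).IsFlat := fun μ h₀ =>
    dressed_isFlat hq_flat hunit hqhat_smooth hg hform h₀
  have hharm : V.IsConstrainedHarmonic (dhat 1) qhat :=
    ⟨hqhat_smooth, hqhat_mem, fun μ hμ => ⟨dhat μ, hrep μ hμ, h_metric μ hμ, hflat μ hμ⟩⟩
  refine ⟨⟨part10_dressedForm _ _ q, part01_dressedForm _ _ q⟩,
    ⟨hflat 1 one_ne_zero, h_metric 1 one_ne_zero, fun s hs p => ?_⟩, hrep, hharm, fun h1 => ?_⟩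
  -- Near `1`, and off the poles of `r`, the gauged operator coincides with `dhat μ`, whose form is
  -- continuous in `μ`.
  · have hlim : Tendsto (fun μ : ℂ => (dhat μ).op s p) (𝓝[≠] 1) (𝓝 ((dhat 1).op s p)) :=
      Connection.tendsto_op fun v => (((h_holo p v).differentiableAt
        (isOpen_ne.mem_nhds one_ne_zero)).continuousAt).tendsto.mono_left nhdsWithin_le_nhds
    refine hlim.congr' ?_
    filter_upwards [r.eventually_mem_dom 1,
      eventually_nhdsWithin_of_eventually_nhds (isOpen_ne.mem_nhds one_ne_zero)] with μ hμ hμ0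
    rw [h_ext μ hμ hμ0 s hs]
  -- At `μ = 1` the spectral family is `d` itself, so `r(1)` gauges `d` into `dhat 1`.
  · have hrel := hg 1 h1 one_ne_zero
    rw [V.familyForm_one] at hrel
    have hi := fun p => (h_orth 1 h1 p).inverse
    exact ⟨_, fun p => rfl, hharm.map_inverse (r.smooth_val 1) (h_orth 1 h1) hrel
      ((r.smooth_val 1).ringInverse (hunit 1 h1)) hi⟩
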